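/- Let $\mathbb Z^2_{even}=\{(x,t)\in\mathbb Z^2: x+t \text{ even}\}$. In the dynamical discrete web every site $z=(x,t)\in\mathbb Z^2_{even}$ carries an arrow $\xi^\tau_z\in\{-1,+1\}$, $\tau\ge 0$, pointing from $(x,t)$ to $(x+\xi^\tau_z,t+1)$: at $\tau=0$ the arrows are independent and take the values $\pm1$ with probability $1/2$ each, and at the rings of a rate-one Poisson clock attached to $z$ the arrow at $z$ is reset to a fresh value $\pm1$ with probability $1/2$ each, all clocks, initial arrows and resets being independent. For $\tau\ge0$ let $S^\tau_0=(S^\tau_0(t))_{t\ge0}$ be the piecewise linear path that starts at the origin $(0,0)$ and follows the arrows $(\xi^\tau_z)_z$ present at dynamical time $\tau$, and let $S$ be a (linearly interpolated) simple symmetric random walk on $\mathbb Z$ started at $0$. For $\delta>0$ and a continuous path $\pi$ on $[0,\infty)$ let $\tilde\pi(t)=\delta\,\pi(t/\delta^2)$, $t\in[0,1]$, and let $$O=\{\pi\in C([0,1]):\ \pi(t)>-1 \text{ for all } t\in[0,1],\ \text{ and } \pi(1)>1\}.$$ Then there exist constants $K,a\in(0,\infty)$ such that for all $\delta>0$ and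 all $\tau,\tau'\ge0$ with $\tau\ne\tau'$, $$\mathbb P\big(\tilde S^\tau_0\in O,\ \tilde S^{\tau'}_0\in O\big)\ \le\ \mathbb P\big(\tilde S\in O\big)^2+K\Big(\frac{\delta}{|\tau-\tau'|}\Big)^a .$$ -/

import Mathlib

open MeasureTheory ProbabilityTheory
open scoped NNReal

namespace DyDW

noncomputable section

/-! ### The discrete web -/

/-- The even sublattice `{(x, t) ∈ ℤ² : x + t even}` of discrete space-time. -/
abbrev ZEven : Type := {z : ℤ × ℤ // Even (z.1 + z.2)}

/-- The space-time origin. -/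
def origin : ZEven := ⟨(0, 0), by simp⟩

/-- The increment carried by an arrow: `true` points right, `false` points left. -/
def incr (b : Bool) : ℤ := if b then 1 else -1

/-- Following the arrow `b` from `(x, t)` leads to `(x ± 1, t + 1)`. -/
def step (z : ZEven) (b : Bool) : ZEven :=
  ⟨(z.1.1 + incr b, z.1.2 + 1), by
    obtain ⟨k, hk⟩ := z.2
    cases b
    · exact ⟨k, by simp [incr]; omega⟩
    · exact ⟨k + 1, by simp [incr]; omega⟩⟩

/-- The space-time point reached from `z` after following `n` arrows of the configuration `A`. -/
def follow (A : ZEven → Bool) (z : ZEven) (n : ℕ) : ZEven :=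
  (fun w => step w (A w))^[n] z

/-- The (integer-time) path from the origin in the discrete web of the arrow configuration `A`. -/
def pathFromOrigin (A : ZEven → Bool) (n : ℕ) : ℤ := (follow A origin n).1.1

/-! ### Piecewise linear paths and diffusive rescaling -/

/-- Linear interpolation of an integer-time path. -/
def interp (s : ℕ → ℤ) (t : ℝ≥0) : ℝ :=
  (s ⌊t⌋₊ : ℝ) + ((t : ℝ) - (⌊t⌋₊ : ℝ)) * ((s (⌊t⌋₊ + 1) : ℝ) - (s ⌊t⌋₊ : ℝ))

theorem interp_eq_of_mem (s : ℕ → ℤ) (n : ℕ) (t : ℝ≥0)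
    (ht : t ∈ Set.Icc (n : ℝ≥0) ((n : ℝ≥0) + 1)) :
    interp s t = (s n : ℝ) + ((t : ℝ) - (n : ℝ)) * ((s (n + 1) : ℝ) - (s n : ℝ)) := by
  rcases lt_or_eq_of_le ht.2 with h | h
  · have hf : ⌊t⌋₊ = n := (Nat.floor_eq_iff (by positivity)).2 ⟨ht.1, h⟩
    simp only [interp, hf]
  · have hf : ⌊t⌋₊ = n + 1 := by
      rw [h]; exact_mod_cast Nat.floor_natCast (R := ℝ≥0) (n + 1)
    simp only [interp, hf]
    rw [h]
    push_cast
    ring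

theorem continuous_interp (s : ℕ → ℤ) : Continuous (interp s) := by
  have hlf : LocallyFinite fun n : ℕ => Set.Icc (n : ℝ≥0) ((n : ℝ≥0) + 1) := by
    intro x
    refine ⟨Set.Iio (x + 1), Iio_mem_nhds (by simp), ?_⟩
    refine (Set.finite_Iio (⌈x + 1⌉₊)).subset ?_
    rintro n ⟨y, hy, hyx⟩
    have h : (n : ℝ≥0) < x + 1 := lt_of_le_of_lt hy.1 hyx
    exact Set.mem_Iio.2 (Nat.lt_ceil.2 h)
  refine hlf.continuous ?_ (fun _ => isClosed_Icc) ?_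
  · refine Set.eq_univ_of_forall fun t => Set.mem_iUnion.2 ⟨⌊t⌋₊, ?_, ?_⟩
    · exact Nat.floor_le (by positivity)
    · exact (Nat.lt_floor_add_one t).le
  · intro n
    refine ContinuousOn.congr ?_ (interp_eq_of_mem s n)
    fun_prop

/-- The continuous piecewise linear path on `[0, ∞)` through an integer-time path. -/
def toPath (s : ℕ → ℤ) : C(ℝ≥0, ℝ) := ⟨interp s, continuous_interp s⟩

/-- The diffusive rescaling `t ↦ π (t / δ²) δ`, as a path on `[0, 1]`. -/
def rescale (δ : ℝ≥0) (π : C(ℝ≥0, ℝ)) : C(unitInterval, ℝ) where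
  toFun t := π (unitInterval.toNNReal t / δ ^ 2) * (δ : ℝ)
  continuous_toFun := by
    have h : Continuous fun t : unitInterval => unitInterval.toNNReal t / δ ^ 2 := by
      simp only [div_eq_mul_inv]
      exact unitInterval.toNNReal_continuous.mul continuous_const
    exact (π.continuous.comp h).mul continuous_const

/-- The paths on `[0, 1]` that stay above `-1` and end above `1`. -/
def O : Set C(unitInterval, ℝ) := {π | (∀ t, -1 < π t) ∧ 1 < π 1}

/-! ### Simple symmetric random walk -/

/-- `S` is a simple symmetric random walk started at `0`. -/
structure IsSimpleSymmetricWalk {Ω : Type*} [MeasurableSpace Ω] (P : Measure Ω)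
    (S : ℕ → Ω → ℤ) : Prop where
  measurable : ∀ n, Measurable (S n)
  start : ∀ᵐ ω ∂P, S 0 ω = 0
  incr_right : ∀ n, P {ω | S (n + 1) ω - S n ω = 1} = 1 / 2
  incr_left : ∀ n, P {ω | S (n + 1) ω - S n ω = -1} = 1 / 2
  indep : iIndepFun (fun (n : ℕ) (ω : Ω) => S (n + 1) ω - S n ω) P

/-! ### The dynamical discrete web -/

/-- `N` is the counting process of a rate one Poisson clock: `N t` is the number of rings
in `(0, t]`. -/
structure IsPoissonClock {Ω : Type*} [MeasurableSpace Ω] (P : Measure Ω)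
    (N : ℝ≥0 → Ω → ℕ) : Prop where
  measurable : ∀ t, Measurable (N t)
  start : ∀ᵐ ω ∂P, N 0 ω = 0
  mono : ∀ᵐ ω ∂P, Monotone fun t => N t ω
  rightCts : ∀ᵐ ω ∂P, ∀ t, ContinuousWithinAt (fun s => N s ω) (Set.Ioi t) t
  law : ∀ s t, s ≤ t → P.map (fun ω => N t ω - N s ω) = poissonMeasure (t - s)
  indep : HasIndepIncrements N P

/-- The random input of the dynamical discrete web. The site `z` carries the clock `N z`, the
initial arrow `η z 0`, and the arrow `η z n` to which it is reset at the `n`-th ring, `n ≥ 1`.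
The arrows are fair, the clocks are rate one Poisson processes, and all of them are independent. -/
structure IsDynamics {Ω : Type*} [MeasurableSpace Ω] (P : Measure Ω)
    (η : ZEven → ℕ → Ω → Bool) (N : ZEven → ℝ≥0 → Ω → ℕ) : Prop where
  measurable_arrow : ∀ z n, Measurable (η z n)
  fair : ∀ z n, P {ω | η z n ω = true} = 1 / 2
  clock : ∀ z, IsPoissonClock P (N z)
  indep_arrows : iIndepFun (fun (p : ZEven × ℕ) (ω : Ω) => η p.1 p.2 ω) P
  indep_clocks : iIndepFun (fun (z : ZEven) (ω : Ω) (t : ℝ≥0) => N z t ω) P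
  indep_arrows_clocks :
    IndepFun (fun (ω : Ω) (p : ZEven × ℕ) => η p.1 p.2 ω)
      (fun (ω : Ω) (z : ZEven) (t : ℝ≥0) => N z t ω) P

/-- The arrow configuration at dynamical time `τ`: each site shows its latest arrow. -/
def config {Ω : Type*} (η : ZEven → ℕ → Ω → Bool) (N : ZEven → ℝ≥0 → Ω → ℕ)
    (τ : ℝ≥0) (ω : Ω) : ZEven → Bool :=
  fun z => η z (N z τ ω) ω

/-- The path from the origin in the dynamical discrete web at dynamical time `τ`. -/
def walk {Ω : Type*} (η : ZEven → ℕ → Ω → Bool) (N : ZEven → ℝ≥0 → Ω → ℕ)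
    (τ : ℝ≥0) (ω : Ω) : ℕ → ℤ :=
  pathFromOrigin (config η N τ ω)

end

end DyDW

open DyDW

/-! The walks at dynamical times `τ` and `τ'` reach fresh sites at every step. Read together they
form a Markov chain on pairs of positions: at different positions the two arrows are independent,
and at a common position they are one and the same arrow with probability `q = exp (-D)`, `D = |τ' -
τ|`, and independent otherwise. For walks starting at the origin the event `O` becomes, at an
integer time `M` of order `δ⁻²`, survival above a level `L` together with a final position above
`c`.

Let `u m x` be the probability of this event for one walk with `m` steps to go (`surv`). For
independent walks `u m x * u m y` would be the exact joint probability. One step of the real pair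
adds to it only `q` times the squared spatial gradient of `u`, and only on the diagonal
(`stepOp_survProd`). Iterating in the manner of Duhamel, the covariance is at most `q` times the
expected sum of squared gradients over the meetings of the pair (`stepOp_iterate_survProd_le`).

Two facts bound this sum. The distance of the walks is a submartingale that gains `1 - q` in mean at
each meeting, so there are at most `2 √M / (1 - q)` meetings on average (`sum_pairOp_diag_le`). The
reflection principle and the local bound for binomial weights give a squared gradient of at most `4
/ (m + 1)`. With more than `R` steps to go these two facts suffice; in the last `R` steps the
meeting constraint is dropped and the squared gradient is averaged along a single walk
(`avg_iterate_survGrad_sq_le`). As `q / (1 - q) ≤ 1 / D`, the total is at most `8 √M / (R D) + 8 √(R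
/ M)`, and the best `R` gives a multiple of `(√M D) ^ (-1/3)`, which is of order `(δ / D) ^ (1/3)`.
-/

namespace DyDW

noncomputable section

/-! ### The averaging operator of simple random walk -/

/-- The transition operator of simple symmetric random walk. -/
def avg (f : ℤ → ℝ) (x : ℤ) : ℝ := (f (x + 1) + f (x - 1)) / 2

/-- Pascal's rule. Linearity, monotonicity and translation invariance of the iterates are read off
this sum. -/
theorem avg_iterate (m : ℕ) (f : ℤ → ℝ) (x : ℤ) :
    avg^[m] f x =
      (∑ ij ∈ Finset.HasAntidiagonal.antidiagonal m, (m.choose ij.1 : ℝ) * f (x + ij.1 - ij.2)) / 2 ^ m := by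
  induction m generalizing x with
  | zero => simp
  | succ m ih =>
    rw [Function.iterate_succ_apply', avg, ih, ih,
      Finset.sum_antidiagonal_choose_succ_mul (fun i j : ℕ => f (x + i - j)), pow_succ]
    have h1 : ∀ ij : ℕ × ℕ, x + (ij.1 : ℤ) - ((ij.2 + 1 : ℕ) : ℤ) = x - 1 + ij.1 - ij.2 := by
      intro ij; push_cast; ring
    have h2 : ∀ ij : ℕ × ℕ, x + ((ij.1 + 1 : ℕ) : ℤ) - (ij.2 : ℤ) = x + 1 + ij.1 - ij.2 := by
      intro ij; push_cast; ring
    simp only [h1, h2]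
    have h3 : ∑ ij ∈ Finset.HasAntidiagonal.antidiagonal m, (m.choose ij.2 : ℝ) * f (x + 1 + ij.1 - ij.2) =
        ∑ ij ∈ Finset.HasAntidiagonal.antidiagonal m, (m.choose ij.1 : ℝ) * f (x + 1 + ij.1 - ij.2) := by
      refine Finset.sum_congr rfl fun ij hij => ?_
      rw [← Nat.choose_symm_of_eq_add (Finset.HasAntidiagonal.mem_antidiagonal.1 hij).symm]
    rw [h3]
    field_simp
    ring

theorem avg_iterate_add (m : ℕ) (f g : ℤ → ℝ) (x : ℤ) :
    avg^[m] (fun y => f y + g y) x = avg^[m] f x + avg^[m] g x := by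
  simp only [avg_iterate, mul_add, Finset.sum_add_distrib, add_div]

theorem avg_iterate_neg (m : ℕ) (f : ℤ → ℝ) (x : ℤ) :
    avg^[m] (fun y => -f y) x = -avg^[m] f x := by
  simp only [avg_iterate, mul_neg, Finset.sum_neg_distrib, neg_div]

theorem avg_iterate_const_mul (m : ℕ) (a : ℝ) (f : ℤ → ℝ) (x : ℤ) :
    avg^[m] (fun y => a * f y) x = a * avg^[m] f x := by
  simp only [avg_iterate, mul_left_comm _ a, ← Finset.mul_sum, mul_div_assoc]

theorem avg_iterate_mono (m : ℕ) {f g : ℤ → ℝ} (h : ∀ y, f y ≤ g y) (x : ℤ) :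
    avg^[m] f x ≤ avg^[m] g x := by
  simp only [avg_iterate]
  gcongr with ij
  exact h _

theorem avg_iterate_translate (m : ℕ) (f : ℤ → ℝ) (x k : ℤ) :
    avg^[m] (fun y => f (y + k)) x = avg^[m] f (x + k) := by
  simp only [avg_iterate]
  congr! 4
  ring

theorem avg_iterate_reflect (m : ℕ) (f : ℤ → ℝ) (x k : ℤ) :
    avg^[m] (fun y => f (k - y)) x = avg^[m] f (k - x) := by
  induction m generalizing x with
  | zero => rfl
  | succ m ih =>
    rw [Function.iterate_succ_apply', Function.iterate_succ_apply', avg, avg, ih, ih,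
      show k - (x + 1) = k - x - 1 by ring, show k - (x - 1) = k - x + 1 by ring, add_comm]

/-! ### Local bound for binomial weights -/

/-- The factor `2 * k + 1` makes the induction close: after multiplication by `(k + 1) ^ 2` the
recursion for central binomial coefficients leaves only `(2 k + 3) (2 k + 1) ≤ 4 (k + 1) ^ 2`. -/
theorem centralBinom_sq_le (k : ℕ) : (2 * k + 1) * k.centralBinom ^ 2 ≤ 16 ^ k := by
  induction k with
  | zero => simp
  | succ k ih =>
    have h := Nat.succ_mul_centralBinom_succ k
    have h2 : (k + 1) ^ 2 * ((2 * (k + 1) + 1) * (k + 1).centralBinom ^ 2) ≤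
        (k + 1) ^ 2 * 16 ^ (k + 1) := by
      calc (k + 1) ^ 2 * ((2 * (k + 1) + 1) * (k + 1).centralBinom ^ 2)
          = (2 * k + 3) * ((k + 1) * (k + 1).centralBinom) ^ 2 := by ring
        _ = 4 * ((2 * k + 3) * (2 * k + 1)) * ((2 * k + 1) * k.centralBinom ^ 2) := by
          rw [h]; ring
        _ ≤ 16 * (k + 1) ^ 2 * 16 ^ k := by
          gcongr ?_ * ?_
          nlinarith
        _ = (k + 1) ^ 2 * 16 ^ (k + 1) := by ring
    exact Nat.le_of_mul_le_mul_left h2 (by positivity)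

theorem succ_mul_choose_half_sq_le (m : ℕ) : (m + 1) * (m.choose (m / 2)) ^ 2 ≤ 4 ^ m := by
  rcases Nat.even_or_odd' m with ⟨k, rfl | rfl⟩
  · have h := centralBinom_sq_le k
    rw [Nat.centralBinom_eq_two_mul_choose] at h
    rw [show 2 * k / 2 = k by omega, pow_mul]
    exact h
  · have h := centralBinom_sq_le (k + 1)
    -- For odd `m` the middle coefficient is half of the next central one.
    have h2 : (k + 1).centralBinom = 2 * (2 * k + 1).choose k := by
      rw [Nat.centralBinom_eq_two_mul_choose, show 2 * (k + 1) = (2 * k + 1) + 1 by ring,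
        Nat.choose_succ_succ, Nat.choose_symm_half]
      ring
    rw [show (2 * k + 1) / 2 = k by omega]
    rw [h2, show (16 : ℕ) ^ (k + 1) = 4 * 4 ^ (2 * k + 1) by
      rw [pow_succ, pow_succ, pow_mul]; norm_num; ring] at h
    nlinarith

theorem choose_div_two_pow_le (m k : ℕ) : (m.choose k : ℝ) / 2 ^ m ≤ 1 / √(m + 1) := by
  have h1 : (m.choose k : ℝ) ≤ m.choose (m / 2) := by exact_mod_cast Nat.choose_le_middle k m
  have h2 : ((m : ℝ) + 1) * (m.choose (m / 2) : ℝ) ^ 2 ≤ 4 ^ m := by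
    exact_mod_cast succ_mul_choose_half_sq_le m
  rw [div_le_div_iff₀ (by positivity) (by positivity), one_mul]
  calc (m.choose k : ℝ) * √(m + 1) ≤ m.choose (m / 2) * √(m + 1) := by gcongr
    _ ≤ 2 ^ m := by
      refine abs_le_of_sq_le_sq' ?_ (by positivity) |>.2
      rw [mul_pow, Real.sq_sqrt (by positivity), ← pow_mul, mul_comm m 2, pow_mul]
      norm_num
      linarith

/-- At most one term of the binomial sum lands on `y`. -/
theorem avg_iterate_single_le (m : ℕ) (x y : ℤ) :
    avg^[m] (fun z => if z = y then 1 else 0) x ≤ 1 / √(m + 1) := by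
  rw [avg_iterate]
  by_cases h : ∃ ij ∈ Finset.HasAntidiagonal.antidiagonal m, x + ((ij : ℕ × ℕ).1 : ℤ) - ij.2 = y
  · obtain ⟨ij, hij, h⟩ := h
    rw [Finset.sum_eq_single_of_mem ij hij]
    · simpa [h] using choose_div_two_pow_le m ij.1
    · intro kl hkl hne
      rw [if_neg, mul_zero]
      intro h'
      rw [Finset.HasAntidiagonal.mem_antidiagonal] at hij hkl
      apply hne
      ext <;> omega
  · push Not at h
    rw [Finset.sum_eq_zero fun ij hij => by rw [if_neg (h ij hij), mul_zero], zero_div]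
    positivity

/-! ### Survival above a level -/

/-- The terminal payoff `1{c < x}`, extended antisymmetrically about the level `L`. -/
def payoff (L c x : ℤ) : ℝ := (if c < x then 1 else 0) - if c < 2 * L - x then 1 else 0

/-- The probability that the walk from `x` stays above `L` and ends above `c` after `m` steps,
written by the reflection principle. -/
def surv (L c : ℤ) (m : ℕ) : ℤ → ℝ := avg^[m] (payoff L c)

/-- Half the spatial increment of `surv`. -/
def survGrad (L c : ℤ) (m : ℕ) (x : ℤ) : ℝ := (surv L c m (x + 1) - surv L c m (x - 1)) / 2

theorem surv_succ (L c : ℤ) (m : ℕ) (x : ℤ) :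
    surv L c (m + 1) x = (surv L c m (x + 1) + surv L c m (x - 1)) / 2 := by
  rw [surv, Function.iterate_succ_apply']; rfl

/-- The payoff is odd about `L`, and averaging commutes with reflection. -/
theorem surv_level (L c : ℤ) (m : ℕ) : surv L c m L = 0 := by
  have h : surv L c m L = -surv L c m L := by
    rw [surv, ← avg_iterate_neg]
    nth_rw 2 [show L = 2 * L - L by ring]
    rw [← avg_iterate_reflect]
    refine congrFun (congrArg _ (funext fun y => ?_)) L
    simp [payoff]
  linarith

/-- The increment of `payoff` charges four points. -/
def payoffIncr (L c x : ℤ) : ℝ :=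
  ((if x = c then 1 else 0) + (if x = c + 1 then 1 else 0)) +
    ((if x = 2 * L - c then 1 else 0) + if x = 2 * L - c - 1 then 1 else 0)

theorem payoff_sub (L c x : ℤ) :
    payoff L c (x + 1) + -payoff L c (x + -1) = payoffIncr L c x := by
  have h1 : ((if c < x + 1 then 1 else 0) - if c < x + -1 then 1 else 0 : ℝ) =
      (if x = c then 1 else 0) + if x = c + 1 then 1 else 0 := by
    split_ifs <;> first | omega | norm_num
  have h2 : ((if c < 2 * L - (x + -1) then 1 else 0) - if c < 2 * L - (x + 1) then 1 else 0 : ℝ) =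
      (if x = 2 * L - c then 1 else 0) + if x = 2 * L - c - 1 then 1 else 0 := by
    split_ifs <;> first | omega | norm_num
  rw [payoffIncr, ← h1, ← h2, payoff, payoff]
  ring

/-- Averaging commutes with translation, so the gradient is itself an average of nonnegative point
masses. This gives its sign, its size and its behaviour under further averaging. -/
theorem survGrad_eq (L c : ℤ) (m : ℕ) (x : ℤ) :
    survGrad L c m x = avg^[m] (payoffIncr L c) x / 2 := by
  rw [survGrad, surv, sub_eq_add_neg x 1, ← avg_iterate_translate, ← avg_iterate_translate,
    sub_eq_add_neg, ← avg_iterate_neg, ← avg_iterate_add]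
  simp only [payoff_sub]

theorem payoffIncr_nonneg (L c x : ℤ) : 0 ≤ payoffIncr L c x := by
  unfold payoffIncr; positivity

theorem avg_iterate_payoffIncr_le (L c : ℤ) (m : ℕ) (x : ℤ) :
    avg^[m] (payoffIncr L c) x ≤ 4 / √(m + 1) := by
  unfold payoffIncr
  rw [avg_iterate_add, avg_iterate_add, avg_iterate_add]
  have h := avg_iterate_single_le m x
  have := h c
  have := h (c + 1)
  have := h (2 * L - c)
  have := h (2 * L - c - 1)
  rw [show 4 / √((m : ℝ) + 1) = 4 * (1 / √((m : ℝ) + 1)) by ring]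
  linarith

theorem survGrad_nonneg (L c : ℤ) (m : ℕ) (x : ℤ) : 0 ≤ survGrad L c m x := by
  rw [survGrad_eq, avg_iterate]
  have := payoffIncr_nonneg L c
  have : 0 ≤ ∑ ij ∈ Finset.HasAntidiagonal.antidiagonal m,
      (m.choose ij.1 : ℝ) * payoffIncr L c (x + ij.1 - ij.2) :=
    Finset.sum_nonneg fun ij _ => mul_nonneg (by positivity) (this _)
  positivity

theorem survGrad_le (L c : ℤ) (m : ℕ) (x : ℤ) : survGrad L c m x ≤ 2 / √(m + 1) := by
  rw [survGrad_eq]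
  have := avg_iterate_payoffIncr_le L c m x
  rw [show 2 / √((m : ℝ) + 1) = (4 / √((m : ℝ) + 1)) / 2 by ring]
  linarith

theorem survGrad_sq_le (L c : ℤ) (m : ℕ) (x : ℤ) : survGrad L c m x ^ 2 ≤ 4 / (m + 1) := by
  calc survGrad L c m x ^ 2 ≤ (2 / √(m + 1)) ^ 2 :=
        pow_le_pow_left₀ (survGrad_nonneg ..) (survGrad_le ..) 2
    _ = 4 / (m + 1) := by rw [div_pow, Real.sq_sqrt (by positivity)]; norm_num

/-- The mean square of the gradient along a single walk. -/
theorem avg_iterate_survGrad_sq_le (L c : ℤ) (n m : ℕ) (x : ℤ) :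
    avg^[n] (fun y => survGrad L c m y ^ 2) x ≤ 4 / (√(m + 1) * √(n + m + 1)) := by
  calc avg^[n] (fun y => survGrad L c m y ^ 2) x
      ≤ avg^[n] (fun y => 1 / √(m + 1) * avg^[m] (payoffIncr L c) y) x := by
        -- One factor of the square is replaced by its supremum. The other stays linear and is
        -- averaged over `n` further steps, which yields the better decay in `n + m`.
        refine avg_iterate_mono n (fun y => ?_) x
        calc survGrad L c m y ^ 2 = survGrad L c m y * survGrad L c m y := sq _
          _ ≤ 2 / √(m + 1) * survGrad L c m y :=
            mul_le_mul_of_nonneg_right (survGrad_le ..) (survGrad_nonneg ..)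
          _ = _ := by rw [survGrad_eq]; ring
    _ = 1 / √(m + 1) * avg^[n + m] (payoffIncr L c) x := by
        rw [avg_iterate_const_mul, Function.iterate_add_apply]
    _ ≤ 1 / √(m + 1) * (4 / √((n + m : ℕ) + 1)) := by
        gcongr
        exact avg_iterate_payoffIncr_le ..
    _ = _ := by push_cast; field_simp

/-! ### Killed transition operators -/

section StepOp

variable {Q I : Type*} [Fintype I]

/-- The transition operator of the chain that moves from `w` to `T w i` with probability `c w i`
and is killed outside `G`. -/
def stepOp (c : Q → I → ℝ) (T : Q → I → Q) (G : Set Q) (f : Q → ℝ) (w : Q) : ℝ :=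
  ∑ i, c w i * G.indicator f (T w i)

variable {c : Q → I → ℝ} {T : Q → I → Q} {G : Set Q}

theorem stepOp_add (f g : Q → ℝ) : stepOp c T G (f + g) = stepOp c T G f + stepOp c T G g := by
  funext w
  simp only [stepOp, Set.indicator_add', Pi.add_apply, mul_add, Finset.sum_add_distrib]

theorem stepOp_smul (a : ℝ) (f : Q → ℝ) : stepOp c T G (a • f) = a • stepOp c T G f := by
  funext w
  simp only [stepOp, Pi.smul_apply, smul_eq_mul, Finset.mul_sum]
  refine Finset.sum_congr rfl fun i _ => ?_
  by_cases hi : T w i ∈ G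
  · simp [hi]; ring
  · simp [hi]

theorem stepOp_iterate_add (n : ℕ) (f g : Q → ℝ) :
    (stepOp c T G)^[n] (f + g) = (stepOp c T G)^[n] f + (stepOp c T G)^[n] g := by
  induction n generalizing f g with
  | zero => rfl
  | succ n ih => simp only [Function.iterate_succ_apply, stepOp_add, ih]

theorem stepOp_iterate_smul (n : ℕ) (a : ℝ) (f : Q → ℝ) :
    (stepOp c T G)^[n] (a • f) = a • (stepOp c T G)^[n] f := by
  induction n generalizing f with
  | zero => rfl
  | succ n ih => simp only [Function.iterate_succ_apply, stepOp_smul, ih]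

theorem stepOp_mono (hc : ∀ w i, 0 ≤ c w i) {f g : Q → ℝ} (h : ∀ w ∈ G, f w ≤ g w) (w : Q) :
    stepOp c T G f w ≤ stepOp c T G g w := by
  refine Finset.sum_le_sum fun i _ => mul_le_mul_of_nonneg_left ?_ (hc w i)
  by_cases hi : T w i ∈ G
  · simpa [hi] using h _ hi
  · simp [hi]

/-- Only values on `G` matter: others are discarded at the first step, and for `n = 0` the point
itself lies in `G`. -/
theorem stepOp_iterate_mono (hc : ∀ w i, 0 ≤ c w i) (n : ℕ) {f g : Q → ℝ}
    (h : ∀ w ∈ G, f w ≤ g w) {w : Q} (hw : w ∈ G) :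
    (stepOp c T G)^[n] f w ≤ (stepOp c T G)^[n] g w := by
  induction n generalizing f g with
  | zero => exact h w hw
  | succ n ih =>
    simp only [Function.iterate_succ_apply]
    exact ih fun w _ => stepOp_mono hc h w

theorem stepOp_iterate_nonneg (hc : ∀ w i, 0 ≤ c w i) (n : ℕ) {f : Q → ℝ} (hf : ∀ w, 0 ≤ f w)
    (w : Q) : 0 ≤ (stepOp c T G)^[n] f w := by
  induction n generalizing w with
  | zero => exact hf w
  | succ n ih =>
    rw [Function.iterate_succ_apply']
    exact Finset.sum_nonneg fun i _ =>
      mul_nonneg (hc w i) (Set.indicator_nonneg (fun w _ => ih w) _)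

theorem stepOp_iterate_le_univ (hc : ∀ w i, 0 ≤ c w i) (n : ℕ) {f : Q → ℝ} (hf : ∀ w, 0 ≤ f w)
    (w : Q) : (stepOp c T G)^[n] f w ≤ (stepOp c T Set.univ)^[n] f w := by
  induction n generalizing w with
  | zero => exact le_rfl
  | succ n ih =>
    simp only [Function.iterate_succ_apply']
    refine Finset.sum_le_sum fun i _ => mul_le_mul_of_nonneg_left ?_ (hc w i)
    by_cases hi : T w i ∈ G
    · simpa [hi] using ih _
    · simpa [hi] using stepOp_iterate_nonneg hc n hf _

end StepOp

/-! ### The pair of walks -/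

/-- The joint law of the arrows seen by the two walks: independent at different sites, and at a
common site equal with probability `q` and independent otherwise. -/
def arrowWeight (q : ℝ) (same : Prop) [Decidable same] (i : Bool × Bool) : ℝ :=
  if same then q * (if i.1 = i.2 then 1 / 2 else 0) + (1 - q) / 4 else 1 / 4

/-- The transition weights of the pair of walks. -/
def pairWeight (q : ℝ) (w : ℤ × ℤ) (i : Bool × Bool) : ℝ := arrowWeight q (w.1 = w.2) i

/-- The moves of the pair of walks. -/
def pairStep (w : ℤ × ℤ) (i : Bool × Bool) : ℤ × ℤ := (w.1 + incr i.1, w.2 + incr i.2)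

/-- The pairs of positions above the level `L`. -/
def above (L : ℤ) : Set (ℤ × ℤ) := {w | L < w.1 ∧ L < w.2}

variable {q : ℝ}

theorem pairWeight_nonneg (hq : 0 ≤ q) (hq1 : q ≤ 1) (w : ℤ × ℤ) (i : Bool × Bool) :
    0 ≤ pairWeight q w i := by
  have : 0 ≤ 1 - q := by linarith
  unfold pairWeight arrowWeight
  positivity

/-- The transition operator of the pair of walks, without killing. -/
abbrev pairOp (q : ℝ) : (ℤ × ℤ → ℝ) → ℤ × ℤ → ℝ := stepOp (pairWeight q) pairStep Set.univ

theorem pairOp_apply (f : ℤ × ℤ → ℝ) (x y : ℤ) : pairOp q f (x, y) =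
    if x = y then q * ((f (x + 1, y + 1) + f (x - 1, y - 1)) / 2) + (1 - q) *
      ((f (x + 1, y + 1) + f (x + 1, y - 1) + f (x - 1, y + 1) + f (x - 1, y - 1)) / 4)
    else (f (x + 1, y + 1) + f (x + 1, y - 1) + f (x - 1, y + 1) + f (x - 1, y - 1)) / 4 := by
  simp only [pairOp, stepOp, pairWeight, arrowWeight, pairStep, Fintype.sum_prod_type,
    Fintype.sum_bool, Set.indicator_univ, incr, ← sub_eq_add_neg, if_true, Bool.false_eq_true,
    if_false, reduceCtorEq]
  split_ifs <;> ring

/-- Whatever `q` is, each coordinate alone is a simple random walk. -/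
theorem pairOp_fst (f : ℤ → ℝ) : pairOp q (fun w => f w.1) = fun w => avg f w.1 := by
  funext ⟨x, y⟩
  rw [pairOp_apply, avg]
  split_ifs <;> ring

theorem pairOp_snd (f : ℤ → ℝ) : pairOp q (fun w => f w.2) = fun w => avg f w.2 := by
  funext ⟨x, y⟩
  rw [pairOp_apply, avg]
  split_ifs <;> ring

theorem pairOp_iterate_fst (n : ℕ) (f : ℤ → ℝ) :
    (pairOp q)^[n] (fun w => f w.1) = fun w => avg^[n] f w.1 := by
  induction n generalizing f with
  | zero => rfl
  | succ n ih => rw [Function.iterate_succ_apply, pairOp_fst, ih, Function.iterate_succ]; rfl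

theorem pairOp_iterate_snd (n : ℕ) (f : ℤ → ℝ) :
    (pairOp q)^[n] (fun w => f w.2) = fun w => avg^[n] f w.2 := by
  induction n generalizing f with
  | zero => rfl
  | succ n ih => rw [Function.iterate_succ_apply, pairOp_snd, ih, Function.iterate_succ]; rfl

/-! ### Moments and the number of meetings -/

theorem avg_iterate_sq (n : ℕ) (x : ℤ) : avg^[n] (fun y => (y : ℝ) ^ 2) x = x ^ 2 + n := by
  induction n generalizing x with
  | zero => simp
  | succ n ih =>
    rw [Function.iterate_succ_apply', avg, ih, ih]
    push_cast
    ring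

theorem avg_iterate_abs_le (n : ℕ) : avg^[n] (fun y => |(y : ℝ)|) 0 ≤ √n := by
  rcases Nat.eq_zero_or_pos n with rfl | hn
  · simp
  have hs : 0 < √(n : ℝ) := Real.sqrt_pos.2 (by exact_mod_cast hn)
  calc avg^[n] (fun y => |(y : ℝ)|) 0
      ≤ avg^[n] (fun y => 1 / (2 * √n) * ((y : ℝ) ^ 2 + n)) 0 := by
        refine avg_iterate_mono n (fun y => ?_) 0
        rw [one_div_mul_eq_div, le_div_iff₀ (by positivity)]
        nlinarith [sq_nonneg (|(y : ℝ)| - √n), sq_abs (y : ℝ), Real.sq_sqrt (Nat.cast_nonneg' n : (0 : ℝ) ≤ n)]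
    _ = 1 / (2 * √n) * (n + n) := by
        rw [avg_iterate_const_mul, avg_iterate_add, avg_iterate_sq, avg_iterate n (fun _ => (n : ℝ)),
          ← Finset.sum_mul]
        have : ∑ ij ∈ Finset.HasAntidiagonal.antidiagonal n, (n.choose ij.1 : ℝ) = 2 ^ n := by
          have := Finset.Nat.sum_antidiagonal_eq_sum_range_succ_mk
            (fun ij : ℕ × ℕ => (n.choose ij.1 : ℝ)) n
          rw [this]
          exact_mod_cast Nat.sum_range_choose n
        rw [this]
        simp
    _ = √n := by
        field_simp
        rw [Real.sq_sqrt (by positivity)]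
        ring

/-- The indicator of the diagonal. -/
def diag (w : ℤ × ℤ) : ℝ := if w.1 = w.2 then 1 else 0

theorem diag_nonneg (w : ℤ × ℤ) : 0 ≤ diag w := by unfold diag; positivity

/-- A discrete Tanaka inequality. Off the diagonal it is convexity of the absolute value; on it the
walks separate to distance `2` with probability `(1 - q) / 2`. -/
theorem abs_sub_le_pairOp (w : ℤ × ℤ) :
    |(w.1 : ℝ) - w.2| + (1 - q) * diag w ≤ pairOp q (fun w => |(w.1 : ℝ) - w.2|) w := by
  obtain ⟨x, y⟩ := w
  rw [pairOp_apply, diag]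
  push_cast
  split_ifs with h
  · subst h
    ring_nf
    norm_num
    linarith
  · have e1 : (x + 1 : ℝ) - (y + 1) = x - y := by ring
    have e2 : (x - 1 : ℝ) - (y - 1) = x - y := by ring
    rw [e1, e2]
    have := abs_add_le ((x + 1 : ℝ) - (y - 1)) (x - 1 - (y + 1))
    rw [show (x + 1 : ℝ) - (y - 1) + (x - 1 - (y + 1)) = 2 * (x - y) by ring, abs_mul,
      abs_of_pos (by norm_num : (0 : ℝ) < 2)] at this
    linarith

/-- The expected number of meetings before time `n` is at most `2 √n / (1 - q)`. -/
theorem sum_pairOp_diag_le (hq : 0 ≤ q) (hq1 : q ≤ 1) (n : ℕ) :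
    (1 - q) * ∑ k ∈ Finset.range n, (pairOp q)^[k] diag (0, 0) ≤ 2 * √n := by
  have hc := pairWeight_nonneg hq hq1
  have h1 : ∀ n : ℕ, (1 - q) * ∑ k ∈ Finset.range n, (pairOp q)^[k] diag (0, 0) ≤
      (pairOp q)^[n] (fun w => |(w.1 : ℝ) - w.2|) (0, 0) := by
    intro n
    induction n with
    | zero => simp
    | succ n ih =>
      rw [Finset.sum_range_succ, mul_add, Function.iterate_succ_apply]
      have h2 : (pairOp q)^[n] ((fun w => |(w.1 : ℝ) - w.2|) + (1 - q) • diag) (0, 0) ≤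
          (pairOp q)^[n] (pairOp q fun w => |(w.1 : ℝ) - w.2|) (0, 0) :=
        stepOp_iterate_mono hc n (fun w _ => abs_sub_le_pairOp w) (Set.mem_univ _)
      rw [stepOp_iterate_add, stepOp_iterate_smul] at h2
      simp only [Pi.add_apply, Pi.smul_apply, smul_eq_mul] at h2
      linarith
  refine (h1 n).trans ?_
  -- The final distance is bounded by `|x| + |y|`, which involves the two marginals only.
  have h2 : (pairOp q)^[n] (fun w => |(w.1 : ℝ) - w.2|) (0, 0) ≤
      (pairOp q)^[n] ((fun w => |(w.1 : ℝ)|) + fun w => |(w.2 : ℝ)|) (0, 0) :=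
    stepOp_iterate_mono hc n (fun w _ => abs_sub _ _) (Set.mem_univ _)
  rw [stepOp_iterate_add] at h2
  have e1 := congrFun (pairOp_iterate_fst (q := q) n fun x => |(x : ℝ)|) (0, 0)
  have e2 := congrFun (pairOp_iterate_snd (q := q) n fun x => |(x : ℝ)|) (0, 0)
  rw [Pi.add_apply, e1, e2] at h2
  have := avg_iterate_abs_le n
  linarith

/-- The squared gradient on the diagonal: the correlation created by one common arrow. -/
def diagGrad (L c : ℤ) (m : ℕ) (w : ℤ × ℤ) : ℝ := diag w * survGrad L c m w.1 ^ 2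

/-- The product of the survival probabilities of the two walks. -/
def survProd (L c : ℤ) (m : ℕ) (w : ℤ × ℤ) : ℝ := surv L c m w.1 * surv L c m w.2

/-- A pair that leaves the region lands on `L` in some coordinate, where `surv` vanishes, so the
killing is invisible to the product. For neighbouring values `a`, `b` of `surv`, a common arrow
gives `(a² + b²) / 2 = ((a + b) / 2)² + ((a - b) / 2)²`; the last square is the excess. -/
theorem stepOp_survProd (L c : ℤ) (m : ℕ) {w : ℤ × ℤ} (hw : w ∈ above L) :
    stepOp (pairWeight q) pairStep (above L) (survProd L c m) w =
      survProd L c (m + 1) w + q * diagGrad L c m w := by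
  have h : stepOp (pairWeight q) pairStep (above L) (survProd L c m) w =
      pairOp q (survProd L c m) w := by
    refine Finset.sum_congr rfl fun i _ => ?_
    congr 1
    rw [Set.indicator_univ]
    by_cases hi : pairStep w i ∈ above L
    · simp [hi]
    rw [Set.indicator_of_notMem hi]
    have hstep : ∀ (x : ℤ) (b : Bool), L < x → L ≤ x + incr b := by
      intro x b hx; cases b <;> simp [incr] <;> omega
    have h1 := hstep w.1 i.1 hw.1
    have h2 := hstep w.2 i.2 hw.2
    have : L = w.1 + incr i.1 ∨ L = w.2 + incr i.2 := by
      by_contra hne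
      push Not at hne
      exact hi ⟨lt_of_le_of_ne h1 hne.1, lt_of_le_of_ne h2 hne.2⟩
    rcases this with h | h <;> simp [survProd, pairStep, ← h, surv_level]
  rw [h]
  obtain ⟨x, y⟩ := w
  rw [pairOp_apply]
  simp only [survProd, diagGrad, diag, surv_succ, survGrad]
  split_ifs with hxy
  · subst hxy; ring
  · ring

/-- Duhamel's formula: the correction produced with `n + m - 1 - k` steps to go is propagated back
over the first `k` steps. Being nonnegative, it may be propagated without killing. -/
theorem stepOp_iterate_survProd_le (hq : 0 ≤ q) (hq1 : q ≤ 1) {L : ℤ} (hL : L < 0) (c : ℤ)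
    (n m : ℕ) :
    (stepOp (pairWeight q) pairStep (above L))^[n] (survProd L c m) (0, 0) ≤
      surv L c (n + m) 0 ^ 2 +
        q * ∑ k ∈ Finset.range n, (pairOp q)^[k] (diagGrad L c (n + m - 1 - k)) (0, 0) := by
  have hc := pairWeight_nonneg hq hq1
  induction n generalizing m with
  | zero => simp [survProd, sq]
  | succ n ih =>
    have h0 : ((0, 0) : ℤ × ℤ) ∈ above L := ⟨hL, hL⟩
    have h1 : (stepOp (pairWeight q) pairStep (above L))^[n + 1] (survProd L c m) (0, 0) ≤
        (stepOp (pairWeight q) pairStep (above L))^[n]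
          (survProd L c (m + 1) + q • diagGrad L c m) (0, 0) :=
      stepOp_iterate_mono hc n (fun w hw => (stepOp_survProd L c m hw).le) h0
    rw [stepOp_iterate_add, stepOp_iterate_smul] at h1
    simp only [Pi.add_apply, Pi.smul_apply, smul_eq_mul] at h1
    have h2 := ih (m + 1)
    have h3 : (stepOp (pairWeight q) pairStep (above L))^[n] (diagGrad L c m) (0, 0) ≤
        (pairOp q)^[n] (diagGrad L c m) (0, 0) :=
      stepOp_iterate_le_univ hc n (fun w => mul_nonneg (diag_nonneg w) (sq_nonneg _)) _
    rw [Finset.sum_range_succ, show n + 1 + m - 1 - n = m by omega,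
      show n + 1 + m = n + (m + 1) by ring, mul_add]
    have h4 := mul_le_mul_of_nonneg_left h3 hq
    linarith

theorem sum_inv_sqrt_le (n : ℕ) (R : ℝ) :
    ∑ j ∈ Finset.range n, (if (j : ℝ) + 1 ≤ R then 1 / √(j + 1) else 0) ≤ 2 * √R := by
  -- The minimum lets the induction telescope `1 / √(n + 1) ≤ 2 (√(n + 1) - √n)` until `n` passes
  -- `R`.
  have key : ∑ j ∈ Finset.range n, (if (j : ℝ) + 1 ≤ R then 1 / √((j : ℝ) + 1) else 0) ≤
      2 * √(min n R) := by
    induction n with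
    | zero => simp
    | succ n ih =>
      rw [Finset.sum_range_succ]
      split_ifs with h
      · have e1 : min (n : ℝ) R = n := min_eq_left (by linarith)
        have e2 : min ((n + 1 : ℕ) : ℝ) R = n + 1 := by
          push_cast; exact min_eq_left h
        rw [e1] at ih
        rw [e2]
        have hs : 0 < √((n : ℝ) + 1) := Real.sqrt_pos.2 (by positivity)
        have h1 : √(n : ℝ) ^ 2 = n := Real.sq_sqrt (by positivity)
        have h2 : √((n : ℝ) + 1) ^ 2 = n + 1 := Real.sq_sqrt (by positivity)
        have : 1 / √((n : ℝ) + 1) ≤ 2 * (√((n : ℝ) + 1) - √n) := by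
          rw [div_le_iff₀ hs]
          nlinarith [sq_nonneg (√((n : ℝ) + 1) - √n)]
        linarith
      · rw [add_zero]
        refine ih.trans ?_
        gcongr
        simp
  refine key.trans ?_
  gcongr
  exact min_le_right _ _

/-- Far from the end (`m + 1 > R`) the gradient is bounded uniformly and the meeting indicator kept.
Near the end the indicator is dropped and the mean square along the first walk is used, since the
uniform bound is poor there. -/
theorem pairOp_iterate_diagGrad_le (hq : 0 ≤ q) (hq1 : q ≤ 1) (L c : ℤ) (k m : ℕ) {R : ℝ}
    (hR : 0 < R) : (pairOp q)^[k] (diagGrad L c m) (0, 0) ≤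
      4 / R * (pairOp q)^[k] diag (0, 0) +
        4 / √(k + m + 1) * (if (m : ℝ) + 1 ≤ R then 1 / √(m + 1) else 0) := by
  have hc := pairWeight_nonneg hq hq1
  have hd : 0 ≤ (pairOp q)^[k] diag (0, 0) := stepOp_iterate_nonneg hc k diag_nonneg _
  split_ifs with h
  · have h1 : (pairOp q)^[k] (diagGrad L c m) (0, 0) ≤
        (pairOp q)^[k] (fun w => survGrad L c m w.1 ^ 2) (0, 0) := by
      refine stepOp_iterate_mono hc k (fun w _ => ?_) (Set.mem_univ _)
      unfold diagGrad diag
      split_ifs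
      · simp
      · simpa using sq_nonneg _
    have e := congrFun (pairOp_iterate_fst (q := q) k fun x => survGrad L c m x ^ 2) (0, 0)
    rw [e] at h1
    have h2 := avg_iterate_survGrad_sq_le L c k m 0
    have h3 : 4 / (√((m : ℝ) + 1) * √(k + m + 1)) = 4 / √(k + m + 1) * (1 / √((m : ℝ) + 1)) := by
      field_simp
    rw [← h3]
    have : 0 ≤ 4 / R * (pairOp q)^[k] diag (0, 0) := by positivity
    linarith
  · rw [mul_zero, add_zero]
    have h1 : (pairOp q)^[k] (diagGrad L c m) (0, 0) ≤ (pairOp q)^[k] ((4 / R) • diag) (0, 0) := by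
      refine stepOp_iterate_mono hc k (fun w _ => ?_) (Set.mem_univ _)
      rw [diagGrad, Pi.smul_apply, smul_eq_mul, mul_comm]
      refine mul_le_mul_of_nonneg_right ((survGrad_sq_le L c m w.1).trans ?_) (diag_nonneg w)
      push Not at h
      gcongr
    rw [stepOp_iterate_smul] at h1
    exact h1

/-- The joint survival probability of the pair nearly factorizes. -/
theorem stepOp_iterate_pair_le (hq : 0 ≤ q) (hq1 : q ≤ 1) {D : ℝ} (hD : 0 < D)
    (hqD : q * D ≤ 1 - q) {L c : ℤ} (hL : L < 0) {M : ℕ} (hM : 0 < M) :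
    (stepOp (pairWeight q) pairStep (above L))^[M] (survProd L c 0) (0, 0) ≤
      surv L c M 0 ^ 2 + 16 * (1 / (√M * D)) ^ (1 / 3 : ℝ) := by
  have hM' : (0 : ℝ) < M := by exact_mod_cast hM
  have hs : 0 < √(M : ℝ) := Real.sqrt_pos.2 hM'
  -- With the cutoff `R = t ^ 2 * M` the far part is at most `8 / (t ^ 2 * √M * D)` and the near
  -- part at most `8 * t`. They balance when `t ^ 3 * √M * D = 1`, whence the exponent `1 / 3`.
  set t : ℝ := (1 / (√M * D)) ^ (1 / 3 : ℝ) with ht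
  have htpos : 0 < t := by positivity
  have ht3 : t ^ 3 * (√M * D) = 1 := by
    rw [ht, ← Real.rpow_natCast, ← Real.rpow_mul (by positivity)]
    norm_num
    field_simp
  have hR : 0 < t ^ 2 * M := by positivity
  refine (stepOp_iterate_survProd_le hq hq1 hL c M 0).trans ?_
  rw [add_zero]
  refine add_le_add_right ?_ _
  set A := ∑ k ∈ Finset.range M, (pairOp q)^[k] diag (0, 0) with hA
  have h1 : ∑ k ∈ Finset.range M, (pairOp q)^[k] (diagGrad L c (M - 1 - k)) (0, 0) ≤
      4 / (t ^ 2 * M) * A + 4 / √M * (2 * √(t ^ 2 * M)) := by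
    calc ∑ k ∈ Finset.range M, (pairOp q)^[k] (diagGrad L c (M - 1 - k)) (0, 0)
        ≤ ∑ k ∈ Finset.range M, (4 / (t ^ 2 * M) * (pairOp q)^[k] diag (0, 0) +
            4 / √M * (if ((M - 1 - k : ℕ) : ℝ) + 1 ≤ t ^ 2 * M then
              1 / √((M - 1 - k : ℕ) + 1) else 0)) := by
          refine Finset.sum_le_sum fun k hk => ?_
          have hk' : k < M := Finset.mem_range.1 hk
          have h := pairOp_iterate_diagGrad_le hq hq1 L c k (M - 1 - k) hR
          have e : (k : ℝ) + (M - 1 - k : ℕ) + 1 = M := by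
            exact_mod_cast (by omega : k + (M - 1 - k) + 1 = M)
          rwa [e] at h
      _ ≤ _ := by
          rw [Finset.sum_add_distrib, ← Finset.mul_sum, ← Finset.mul_sum,
            Finset.sum_range_reflect
              (fun j : ℕ => if (j : ℝ) + 1 ≤ t ^ 2 * M then 1 / √((j : ℝ) + 1) else 0)]
          have := sum_inv_sqrt_le M (t ^ 2 * M)
          gcongr
  have hsq : √(t ^ 2 * M) = t * √M := by
    rw [Real.sqrt_mul (by positivity), Real.sqrt_sq htpos.le]
  have h2 : 4 / √M * (2 * √(t ^ 2 * M)) = 8 * t := by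
    rw [hsq]; field_simp; norm_num
  rw [h2] at h1
  have hA0 : 0 ≤ A := Finset.sum_nonneg fun k _ =>
    stepOp_iterate_nonneg (pairWeight_nonneg hq hq1) k diag_nonneg _
  have h3 : q * D * A ≤ 2 * √M :=
    (mul_le_mul_of_nonneg_right hqD hA0).trans (sum_pairOp_diag_le hq hq1 M)
  have h4 : q * (4 / (t ^ 2 * M) * A) ≤ 8 * t := by
    have hss : √(M : ℝ) ^ 2 = M := Real.sq_sqrt hM'.le
    have : q * (4 / (t ^ 2 * M) * A) = 4 / (t ^ 2 * M * D) * (q * D * A) := by field_simp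
    rw [this]
    calc 4 / (t ^ 2 * M * D) * (q * D * A) ≤ 4 / (t ^ 2 * M * D) * (2 * √M) := by gcongr
      _ = 8 * t := by
        rw [div_mul_eq_mul_div, div_eq_iff (by positivity)]
        linear_combination (-8 * √M) * ht3 + 8 * t ^ 3 * D * hss
  calc q * ∑ k ∈ Finset.range M, (pairOp q)^[k] (diagGrad L c (M - 1 - k)) (0, 0)
      ≤ q * (4 / (t ^ 2 * M) * A + 8 * t) := by gcongr
    _ = q * (4 / (t ^ 2 * M) * A) + q * (8 * t) := by ring
    _ ≤ 8 * t + 1 * (8 * t) := by gcongr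
    _ = 16 * t := by ring

/-! ### Chains driven by random input -/

section Chain

/-- The histories of `X` that stay in `G` up to time `n`. -/
def alive {Ω Q : Type*} (X : ℕ → Ω → Q) (G : Set Q) (n : ℕ) : Set Ω := {ω | ∀ k ≤ n, X k ω ∈ G}

theorem measureReal_inter_of_indep {Ω : Type*} [MeasurableSpace Ω] {P : Measure Ω}
    {m₁ m₂ : MeasurableSpace Ω} (h : Indep m₁ m₂ P) {s t : Set Ω}
    (hs : MeasurableSet[m₁] s) (ht : MeasurableSet[m₂] t) :
    P.real (s ∩ t) = P.real s * P.real t := by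
  simp only [measureReal_def, ← ENNReal.toReal_mul]
  rw [(Indep_iff m₁ m₂ P).1 h s t hs ht]

/-- The history of a process measurable up to time `n`. -/
theorem measurableSet_alive_inter {Ω Q : Type*} [Countable Q] [MeasurableSpace Q]
    [DiscreteMeasurableSpace Q] {m : MeasurableSpace Ω} {X : ℕ → Ω → Q} {n : ℕ}
    (hX : ∀ k ≤ n, Measurable[m] (X k)) (G : Set Q) (w : Q) :
    MeasurableSet[m] (alive X G n ∩ {ω | X n ω = w}) := by
  have : alive X G n = ⋂ k, ⋂ _ : k ≤ n, X k ⁻¹' G := by ext; simp [alive]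
  rw [this]
  exact (MeasurableSet.iInter fun k => MeasurableSet.iInter fun hk => hX k hk (.of_discrete)).inter
    (hX n le_rfl (measurableSet_singleton w))

variable {Ω : Type*} [MeasurableSpace Ω] {P : Measure Ω} [IsProbabilityMeasure P]

theorem measureReal_eq_half {Y : Ω → Bool} (hY : Measurable Y)
    (h : P {ω | Y ω = true} = 1 / 2) (b : Bool) : P.real {ω | Y ω = b} = 1 / 2 := by
  have ht : P.real {ω | Y ω = true} = 1 / 2 := by rw [measureReal_def, h]; simp
  cases b
  · have hc : {ω | Y ω = false} = {ω | Y ω = true}ᶜ := by ext ω; simp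
    have hm : MeasurableSet {ω | Y ω = true} := hY (measurableSet_singleton true)
    rw [hc, probReal_compl_eq_one_sub hm, ht]
    norm_num
  · exact ht

/-- A process whose moves have the prescribed conditional law given its past is described by the
killed transition operator. -/
theorem integral_alive_eq_stepOp {Q I : Type*} [Countable Q] [MeasurableSpace Q]
    [DiscreteMeasurableSpace Q] [Fintype I] [MeasurableSpace I] [DiscreteMeasurableSpace I]
    {X : ℕ → Ω → Q} {Y : ℕ → Ω → I} {c : Q → I → ℝ} {T : Q → I → Q} {G : Set Q} {w₀ : Q}
    (hw₀ : w₀ ∈ G) (hX₀ : ∀ ω, X 0 ω = w₀) (hX : ∀ n ω, X (n + 1) ω = T (X n ω) (Y n ω))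
    (hXm : ∀ n, Measurable (X n)) (hYm : ∀ n, Measurable (Y n))
    (h : ∀ n w i, P.real (alive X G n ∩ {ω | X n ω = w} ∩ {ω | Y n ω = i}) =
      P.real (alive X G n ∩ {ω | X n ω = w}) * c w i) (n : ℕ) (f : Q → ℝ) :
    ∫ ω, (alive X G n).indicator (fun ω => f (X n ω)) ω ∂P = (stepOp c T G)^[n] f w₀ := by
  classical
  -- Finitely many positions are reachable in `n` steps, so the integrals below are finite sums.
  have hfin : ∀ n, ∃ R : Finset Q, ∀ ω, X n ω ∈ R := by
    intro n
    induction n with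
    | zero => exact ⟨{w₀}, fun ω => by simp [hX₀]⟩
    | succ n ih =>
      obtain ⟨R, hR⟩ := ih
      refine ⟨(R ×ˢ Finset.univ).image fun p => T p.1 p.2, fun ω => ?_⟩
      rw [hX]
      exact Finset.mem_image.2 ⟨(X n ω, Y n ω), by simp [hR ω], rfl⟩
  have halive : ∀ n, MeasurableSet (alive X G n) := by
    intro n
    have : alive X G n = ⋂ k, ⋂ _ : k ≤ n, X k ⁻¹' G := by ext; simp [alive]
    rw [this]
    exact MeasurableSet.iInter fun k => MeasurableSet.iInter fun _ => hXm k (.of_discrete)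
  have hXs : ∀ n w, MeasurableSet {ω | X n ω = w} := fun n w => hXm n (measurableSet_singleton w)
  have hYs : ∀ n i, MeasurableSet {ω | Y n ω = i} := fun n i => hYm n (measurableSet_singleton i)
  induction n generalizing f with
  | zero =>
    have : ∀ ω, (alive X G 0).indicator (fun ω => f (X 0 ω)) ω = f w₀ := by
      intro ω
      have : ω ∈ alive X G 0 := by
        intro k hk
        rw [Nat.le_zero.1 hk, hX₀]
        exact hw₀
      rw [Set.indicator_of_mem this, hX₀]
    simp [this]
  | succ n ih =>
    rw [Function.iterate_succ_apply, ← ih]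
    obtain ⟨R, hR⟩ := hfin n
    have h1 : ∀ ω, (alive X G (n + 1)).indicator (fun ω => f (X (n + 1) ω)) ω =
        ∑ w ∈ R, ∑ i, (alive X G n ∩ {ω | X n ω = w} ∩ {ω | Y n ω = i}).indicator
          (fun _ => G.indicator f (T w i)) ω := by
      intro ω
      rw [Finset.sum_eq_single_of_mem (X n ω) (hR ω), Finset.sum_eq_single (Y n ω)]
      · by_cases hω : ω ∈ alive X G n
        · have hmem : ω ∈ alive X G n ∩ {ω' | X n ω' = X n ω} ∩ {ω' | Y n ω' = Y n ω} :=
            ⟨⟨hω, rfl⟩, rfl⟩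
          by_cases hG : X (n + 1) ω ∈ G
          · have : ω ∈ alive X G (n + 1) := fun k hk => by
              rcases Nat.le_succ_iff.1 hk with hk | rfl
              exacts [hω k hk, hG]
            rw [Set.indicator_of_mem this, Set.indicator_of_mem hmem, ← hX,
              Set.indicator_of_mem hG]
          · have hnot : ω ∉ alive X G (n + 1) := fun h => hG (h _ le_rfl)
            rw [Set.indicator_of_notMem hnot, Set.indicator_of_mem hmem, ← hX,
              Set.indicator_of_notMem hG]
        · have hnot : ω ∉ alive X G (n + 1) := fun h => hω fun k hk => h k (hk.trans n.le_succ)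
          rw [Set.indicator_of_notMem hnot, Set.indicator_of_notMem fun h => hω h.1.1]
      · intro i _ hi
        exact Set.indicator_of_notMem (fun h => hi h.2.symm) _
      · simp
      · intro w _ hw
        exact Finset.sum_eq_zero fun i _ => Set.indicator_of_notMem (fun h => hw h.1.2.symm) _
    have h2 : ∀ ω, (alive X G n).indicator (fun ω => stepOp c T G f (X n ω)) ω =
        ∑ w ∈ R, (alive X G n ∩ {ω | X n ω = w}).indicator (fun _ => stepOp c T G f w) ω := by
      intro ω
      rw [Finset.sum_eq_single_of_mem (X n ω) (hR ω)]
      · by_cases hω : ω ∈ alive X G n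
        · have hmem : ω ∈ alive X G n ∩ {ω' | X n ω' = X n ω} := ⟨hω, rfl⟩
          rw [Set.indicator_of_mem hω, Set.indicator_of_mem hmem]
        · rw [Set.indicator_of_notMem hω, Set.indicator_of_notMem fun h => hω h.1]
      · intro w _ hw
        exact Set.indicator_of_notMem (fun h => hw h.2.symm) _
    simp only [h1, h2]
    have hm1 : ∀ w, MeasurableSet (alive X G n ∩ {ω | X n ω = w}) :=
      fun w => (halive n).inter (hXs n w)
    have hm2 : ∀ w i, MeasurableSet (alive X G n ∩ {ω | X n ω = w} ∩ {ω | Y n ω = i}) :=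
      fun w i => (hm1 w).inter (hYs n i)
    rw [integral_finsetSum _ fun w _ => integrable_finsetSum _ fun i _ =>
        (integrable_const _).indicator (hm2 w i),
      integral_finsetSum _ fun w _ => (integrable_const _).indicator (hm1 w)]
    refine Finset.sum_congr rfl fun w _ => ?_
    rw [integral_finsetSum _ fun i _ => (integrable_const _).indicator (hm2 w i),
      integral_indicator_const _ (hm1 w), stepOp, smul_eq_mul, Finset.mul_sum]
    refine Finset.sum_congr rfl fun i _ => ?_
    rw [integral_indicator_const _ (hm2 w i), h, smul_eq_mul, mul_assoc]

/-- The event form of `integral_alive_eq_stepOp`. -/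
theorem measureReal_alive_eq_stepOp {Q I : Type*} [Countable Q] [MeasurableSpace Q]
    [DiscreteMeasurableSpace Q] [Fintype I] [MeasurableSpace I] [DiscreteMeasurableSpace I]
    {X : ℕ → Ω → Q} {Y : ℕ → Ω → I} {c : Q → I → ℝ} {T : Q → I → Q} {G : Set Q} {w₀ : Q}
    (hw₀ : w₀ ∈ G) (hX₀ : ∀ ω, X 0 ω = w₀) (hX : ∀ n ω, X (n + 1) ω = T (X n ω) (Y n ω))
    (hXm : ∀ n, Measurable (X n)) (hYm : ∀ n, Measurable (Y n))
    (h : ∀ n w i, P.real (alive X G n ∩ {ω | X n ω = w} ∩ {ω | Y n ω = i}) =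
      P.real (alive X G n ∩ {ω | X n ω = w}) * c w i) (n : ℕ) (f : Q → ℝ) (B : Set Q)
    (hf : ∀ w ∈ G, f w = B.indicator 1 w) :
    P.real (alive X G n ∩ {ω | X n ω ∈ B}) = (stepOp c T G)^[n] f w₀ := by
  rw [← integral_alive_eq_stepOp hw₀ hX₀ hX hXm hYm h]
  have hm : MeasurableSet (alive X G n ∩ {ω | X n ω ∈ B}) := by
    have : alive X G n = ⋂ k, ⋂ _ : k ≤ n, X k ⁻¹' G := by ext; simp [alive]
    rw [this]
    exact (MeasurableSet.iInter fun k => MeasurableSet.iInter fun _ => hXm k (.of_discrete)).inter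
      (hXm n (.of_discrete))
  rw [← integral_indicator_one hm]
  refine integral_congr_ae (.of_forall fun ω => ?_)
  by_cases hω : ω ∈ alive X G n
  · simp only [Set.indicator_of_mem hω, hf _ (hω n le_rfl)]
    by_cases hB : X n ω ∈ B
    · have hmem : ω ∈ alive X G n ∩ {ω | X n ω ∈ B} := ⟨hω, hB⟩
      rw [Set.indicator_of_mem hmem, Set.indicator_of_mem hB]; rfl
    · rw [Set.indicator_of_notMem fun h => hB h.2, Set.indicator_of_notMem hB]
  · rw [Set.indicator_of_notMem fun h => hω h.1, Set.indicator_of_notMem hω]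

/-- An event chosen by a discrete random index. -/
theorem measureReal_random_index {ι : Type*} [Countable ι] [MeasurableSpace ι]
    [MeasurableSingletonClass ι] {X : Ω → ι} (hX : Measurable X) {E : ι → Set Ω}
    (hE : ∀ x, MeasurableSet (E x)) (B : Set ι) {c : ℝ} (hc : 0 ≤ c)
    (h : ∀ x ∈ B, P.real ({ω | X ω = x} ∩ E x) = P.real {ω | X ω = x} * c) :
    P.real {ω | X ω ∈ B ∧ ω ∈ E (X ω)} = P.real {ω | X ω ∈ B} * c := by
  have hXs : ∀ x, MeasurableSet {ω | X ω = x} := fun x => hX (measurableSet_singleton x)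
  have h' : ∀ x ∈ B, P ({ω | X ω = x} ∩ E x) = P {ω | X ω = x} * ENNReal.ofReal c := by
    intro x hx
    rw [← ofReal_measureReal, ← ofReal_measureReal (s := {ω | X ω = x}), h x hx,
      ENNReal.ofReal_mul measureReal_nonneg]
  have e1 : {ω | X ω ∈ B ∧ ω ∈ E (X ω)} = ⋃ x ∈ B, {ω | X ω = x} ∩ E x := by
    ext ω; simp
  have e2 : {ω | X ω ∈ B} = ⋃ x ∈ B, {ω | X ω = x} := by ext ω; simp
  have hd : B.PairwiseDisjoint fun x => {ω | X ω = x} := by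
    intro x _ y _ hxy
    exact Set.disjoint_left.2 fun ω (hx : X ω = x) (hy : X ω = y) => hxy (hx.symm.trans hy)
  have key : P {ω | X ω ∈ B ∧ ω ∈ E (X ω)} = P {ω | X ω ∈ B} * ENNReal.ofReal c := by
    rw [e1, e2, measure_biUnion B.to_countable (hd.mono fun x => Set.inter_subset_left)
        fun x _ => (hXs x).inter (hE x),
      measure_biUnion B.to_countable hd fun x _ => hXs x, ← ENNReal.tsum_mul_right]
    exact tsum_congr fun x => h' x x.2
  rw [measureReal_def, key, ENNReal.toReal_mul, ENNReal.toReal_ofReal hc, measureReal_def]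

end Chain

/-! ### The single walk -/

/-- For `x > L` the reflected point lies below `L ≤ c`, so on survivors the antisymmetric payoff is
the plain indicator. -/
theorem payoff_of_gt {L c x : ℤ} (hc : L ≤ c) (hx : L < x) :
    payoff L c x = (Set.Ioi c).indicator 1 x := by
  rw [payoff, if_neg (by omega : ¬ c < 2 * L - x), sub_zero, Set.indicator_apply]
  rfl

/-- The reflection principle: unit steps from above `L` cannot jump over `L`, where `surv` is zero,
so killing changes nothing. -/
theorem stepOp_iterate_surv {L : ℤ} (hL : L < 0) (c : ℤ) (n m : ℕ) :
    (stepOp (fun (_ : ℤ) (_ : Bool) => (1 / 2 : ℝ)) (fun x b => x + incr b) (Set.Ioi L))^[n]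
      (surv L c m) 0 = surv L c (n + m) 0 := by
  induction n generalizing m with
  | zero => simp
  | succ n ih =>
    have hop : ∀ x ∈ Set.Ioi L, stepOp (fun (_ : ℤ) (_ : Bool) => (1 / 2 : ℝ))
        (fun x b => x + incr b) (Set.Ioi L) (surv L c m) x = surv L c (m + 1) x := by
      intro x hx
      have hstep : ∀ b : Bool,
          (Set.Ioi L).indicator (surv L c m) (x + incr b) = surv L c m (x + incr b) := by
        intro b
        by_cases hb : x + incr b ∈ Set.Ioi L
        · exact Set.indicator_of_mem hb _
        · have : x + incr b = L := by
            rw [Set.mem_Ioi] at hx hb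
            cases b <;> simp [incr] at hb ⊢ <;> omega
          rw [Set.indicator_of_notMem hb, this, surv_level]
      simp only [stepOp, hstep, Fintype.sum_bool, surv_succ]
      simp [incr, sub_eq_add_neg]
      ring
    rw [Function.iterate_succ_apply, show n + 1 + m = n + (m + 1) by ring, ← ih]
    exact le_antisymm
      (stepOp_iterate_mono (fun _ _ => by norm_num) n (fun x hx => (hop x hx).le) hL)
      (stepOp_iterate_mono (fun _ _ => by norm_num) n (fun x hx => (hop x hx).ge) hL)

section Single

variable {Ω : Type*} [MeasurableSpace Ω] {P : Measure Ω} [IsProbabilityMeasure P]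

/-- Almost surely the walk starts at `0` and moves by unit steps. -/
theorem IsSimpleSymmetricWalk.ae_step {S : ℕ → Ω → ℤ} (hS : IsSimpleSymmetricWalk P S) :
    ∀ᵐ ω ∂P, S 0 ω = 0 ∧ ∀ n, S (n + 1) ω = S n ω + incr (decide (S (n + 1) ω - S n ω = 1)) := by
  refine hS.start.and (ae_all_iff.2 fun n => ?_)
  have hm : Measurable fun ω => S (n + 1) ω - S n ω :=
    (hS.measurable (n + 1)).sub (hS.measurable n)
  have hd : Disjoint {ω | S (n + 1) ω - S n ω = 1} {ω | S (n + 1) ω - S n ω = -1} :=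
    Set.disjoint_left.2 fun ω (h1 : _ = _) (h2 : _ = _) => by omega
  have hu : P ({ω | S (n + 1) ω - S n ω = 1} ∪ {ω | S (n + 1) ω - S n ω = -1}) = 1 := by
    rw [measure_union hd (hm (measurableSet_singleton (-1))), hS.incr_right, hS.incr_left]
    exact ENNReal.add_halves 1
  have hae := (mem_ae_iff_prob_eq_one
    ((hm (measurableSet_singleton 1)).union (hm (measurableSet_singleton (-1))))).2 hu
  filter_upwards [hae] with ω hω
  rcases hω with h | h
  · have h : S (n + 1) ω - S n ω = 1 := h
    simp [h, incr]; omega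
  · have h : S (n + 1) ω - S n ω = -1 := h
    simp [h, incr]; omega

/-- The chain lemma needs its recursion at every `ω`, whereas `S` obeys it only almost surely. Hence
the detour through the partial sums `X` of the signs `Y`. -/
theorem IsSimpleSymmetricWalk.measureReal_surv {S : ℕ → Ω → ℤ} (hS : IsSimpleSymmetricWalk P S)
    {L c : ℤ} (hL : L < 0) (hc : L ≤ c) (M : ℕ) :
    P.real {ω | (∀ k ≤ M, L < S k ω) ∧ c < S M ω} = surv L c M 0 := by
  set Y : ℕ → Ω → Bool := fun n ω => decide (S (n + 1) ω - S n ω = 1) with hY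
  set X : ℕ → Ω → ℤ := fun n ω => ∑ k ∈ Finset.range n, incr (Y k ω) with hX
  have hincr : ∀ n, Measurable fun ω => S (n + 1) ω - S n ω :=
    fun n => (hS.measurable (n + 1)).sub (hS.measurable n)
  have hYm : ∀ n, Measurable (Y n) := fun n =>
    (measurable_of_countable fun d : ℤ => decide (d = 1)).comp (hincr n)
  have hYind : iIndepFun Y P :=
    hS.indep.comp (fun _ d => decide (d = 1)) fun _ => measurable_of_countable _
  have hXm' : ∀ (m : MeasurableSpace Ω) (n : ℕ), (∀ k < n, Measurable[m] (Y k)) →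
      Measurable[m] (X n) := fun m n h =>
    Finset.measurable_fun_sum _ fun k hk =>
      (measurable_of_countable incr).comp (h k (Finset.mem_range.1 hk))
  have hfair : ∀ n b, P.real {ω | Y n ω = b} = 1 / 2 := by
    intro n b
    refine measureReal_eq_half (hYm n) ?_ b
    simpa only [hY, decide_eq_true_eq] using hS.incr_right n
  have hae : ∀ᵐ ω ∂P, ∀ n, S n ω = X n ω := by
    filter_upwards [hS.ae_step] with ω hω n
    induction n with
    | zero => simp [hX, hω.1]
    | succ n ih =>
      have hs : X (n + 1) ω = X n ω + incr (Y n ω) := Finset.sum_range_succ _ _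
      rw [hs, ← ih]
      exact hω.2 n
  have key := measureReal_alive_eq_stepOp (P := P) (X := X) (Y := Y) (c := fun _ _ => 1 / 2)
    (T := fun x b => x + incr b) (G := Set.Ioi L) (w₀ := 0) hL (fun ω => by simp [hX])
    (fun n ω => by simp [hX, Finset.sum_range_succ]) (fun n => hXm' _ n fun k _ => hYm k) hYm
    (fun n w i => by
      rw [← hfair n i]
      refine measureReal_inter_of_indep (indep_iSup_of_disjoint (fun k => (hYm k).comap_le) hYind
        (S := {k | k < n}) (T := {n}) (by simp)) ?_ ?_
      · refine measurableSet_alive_inter (fun k hk => hXm' _ k fun j hj => ?_) _ _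
        exact (comap_measurable (Y j)).mono
          (le_iSup₂_of_le j (lt_of_lt_of_le hj hk) le_rfl) le_rfl
      · have hn : Measurable[⨆ k ∈ ({n} : Set ℕ), MeasurableSpace.comap (Y k) inferInstance] (Y n) :=
          (comap_measurable (Y n)).mono (le_iSup₂_of_le n rfl le_rfl) le_rfl
        exact hn (measurableSet_singleton i))
    M (surv L c 0) (Set.Ioi c) (fun w hw => payoff_of_gt hc hw)
  rw [stepOp_iterate_surv hL, add_zero] at key
  rw [← key]
  refine measureReal_congr ?_
  filter_upwards [hae] with ω hω
  refine propext ?_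
  change ((∀ k ≤ M, L < S k ω) ∧ c < S M ω) ↔ ((∀ k ≤ M, L < X k ω) ∧ c < X M ω)
  simp only [hω]

end Single

/-! ### The pair of walks in the dynamical discrete web -/

theorem follow_succ (A : ZEven → Bool) (z : ZEven) (n : ℕ) :
    follow A z (n + 1) = step (follow A z n) (A (follow A z n)) :=
  Function.iterate_succ_apply' ..

theorem follow_origin_time (A : ZEven → Bool) (n : ℕ) : (follow A origin n).1.2 = n := by
  induction n with
  | zero => rfl
  | succ n ih => rw [follow_succ]; simp [step, ih]

theorem pathFromOrigin_succ (A : ZEven → Bool) (n : ℕ) :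
    pathFromOrigin A (n + 1) = pathFromOrigin A n + incr (A (follow A origin n)) := by
  rw [pathFromOrigin, follow_succ]; rfl

section Sites

variable {Ω : Type*} {η : ZEven → ℕ → Ω → Bool} {N : ZEven → ℝ≥0 → Ω → ℕ}

/-- The σ-algebras of the single arrows and of the single clocks. -/
@[reducible]
def inputSigma (η : ZEven → ℕ → Ω → Bool) (N : ZEven → ℝ≥0 → Ω → ℕ) :
    (ZEven × ℕ) ⊕ ZEven → MeasurableSpace Ω :=
  Sum.elim (fun p => MeasurableSpace.comap (η p.1 p.2) inferInstance)
    (fun z => MeasurableSpace.comap (fun ω t => N z t ω) inferInstance)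

/-- The site to which an input belongs. -/
def inputSite : (ZEven × ℕ) ⊕ ZEven → ZEven := Sum.elim Prod.fst id

/-- The σ-algebra of all inputs at the sites in `A`. -/
@[reducible]
def siteSigma (η : ZEven → ℕ → Ω → Bool) (N : ZEven → ℝ≥0 → Ω → ℕ) (A : Set ZEven) :
    MeasurableSpace Ω :=
  ⨆ i ∈ inputSite ⁻¹' A, inputSigma η N i

theorem measurable_arrow_siteSigma {A : Set ZEven} {z : ZEven} (hz : z ∈ A) (n : ℕ) :
    Measurable[siteSigma η N A] (η z n) :=
  (comap_measurable (η z n)).mono (le_iSup₂_of_le (f := fun i _ => inputSigma η N i)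
    (Sum.inl (z, n)) hz le_rfl) le_rfl

theorem measurable_clock_siteSigma {A : Set ZEven} {z : ZEven} (hz : z ∈ A) (t : ℝ≥0) :
    Measurable[siteSigma η N A] (N z t) := by
  have h : Measurable[siteSigma η N A] fun ω t => N z t ω :=
    (comap_measurable fun ω t => N z t ω).mono (le_iSup₂_of_le (f := fun i _ => inputSigma η N i)
      (Sum.inr z) hz le_rfl) le_rfl
  exact (measurable_pi_apply t).comp h

theorem measurable_config {A : Set ZEven} {z : ZEven} (hz : z ∈ A) (τ : ℝ≥0) :
    Measurable[siteSigma η N A] fun ω => config η N τ ω z := by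
  let _ := siteSigma η N A
  have h : Measurable fun p : Ω × ℕ => η z p.2 p.1 :=
    measurable_from_prod_countable_left fun n => measurable_arrow_siteSigma hz n
  exact h.comp (measurable_id.prodMk (measurable_clock_siteSigma hz τ))

/-- The sites before time `n`. -/
def sitesBefore (n : ℕ) : Set ZEven := {z | z.1.2 < n}

/-- After `k` steps the path is at time level `k`, so its first `n` steps read only arrows at levels
below `n`. This makes the arrows at level `n` independent of the past. -/
theorem measurable_follow (τ : ℝ≥0) {k n : ℕ} (hk : k ≤ n) :
    Measurable[siteSigma η N (sitesBefore n)] fun ω => follow (config η N τ ω) origin k := by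
  induction k with
  | zero => exact measurable_const
  | succ k ih =>
    refine @measurable_to_countable' _ _ _ _ (siteSigma η N (sitesBefore n)) _ fun w => ?_
    have e : (fun ω => follow (config η N τ ω) origin (k + 1)) ⁻¹' {w} =
        ⋃ z ∈ sitesBefore n, {ω | follow (config η N τ ω) origin k = z} ∩
          {ω | step z (config η N τ ω z) = w} := by
      ext ω
      simp only [Set.mem_preimage, Set.mem_singleton_iff, follow_succ, Set.mem_iUnion,
        Set.mem_inter_iff, Set.mem_ofPred_eq]
      constructor
      · intro h
        refine ⟨_, ?_, rfl, h⟩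
        rw [sitesBefore, Set.mem_ofPred_eq, follow_origin_time]
        exact_mod_cast hk
      · rintro ⟨z, _, rfl, h⟩
        exact h
    rw [e]
    refine MeasurableSet.biUnion (Set.to_countable _) fun z hz => ?_
    refine MeasurableSet.inter (ih (by omega) (measurableSet_singleton z)) ?_
    exact ((measurable_of_countable (step z)).comp (measurable_config hz τ))
      (measurableSet_singleton w)

theorem measurable_pathFromOrigin (τ : ℝ≥0) {k n : ℕ} (hk : k ≤ n) :
    Measurable[siteSigma η N (sitesBefore n)] fun ω => pathFromOrigin (config η N τ ω) k :=
  (measurable_of_countable fun z : ZEven => z.1.1).comp (measurable_follow τ hk)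

end Sites

section Dynamics

variable {Ω : Type*} [mΩ : MeasurableSpace Ω] {P : Measure Ω}
  {η : ZEven → ℕ → Ω → Bool} {N : ZEven → ℝ≥0 → Ω → ℕ}

theorem IsDynamics.inputSigma_le (h : IsDynamics P η N) (i : (ZEven × ℕ) ⊕ ZEven) :
    inputSigma η N i ≤ mΩ := by
  rcases i with p | z
  · exact (h.measurable_arrow p.1 p.2).comap_le
  · exact (measurable_pi_lambda _ fun t => (h.clock z).measurable t).comap_le

theorem IsDynamics.siteSigma_le (h : IsDynamics P η N) (A : Set ZEven) :
    siteSigma η N A ≤ mΩ :=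
  iSup₂_le fun i _ => h.inputSigma_le i

/-- Arrows, clocks, and the two families jointly: the three independence assumptions merge into one,
so that disjoint sets of sites carry independent inputs. -/
theorem IsDynamics.iIndep_inputSigma (h : IsDynamics P η N) : iIndep (inputSigma η N) P := by
  rw [iIndep_iff]
  intro s f hf
  have e : ⋂ i ∈ s, f i = (⋂ p ∈ s.toLeft, f (Sum.inl p)) ∩ ⋂ z ∈ s.toRight, f (Sum.inr z) := by
    ext ω
    simp
  have hl : P (⋂ p ∈ s.toLeft, f (Sum.inl p)) = ∏ p ∈ s.toLeft, P (f (Sum.inl p)) :=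
    (iIndep_iff _ _).1 h.indep_arrows s.toLeft fun p hp => hf _ (Finset.mem_toLeft.1 hp)
  have hr : P (⋂ z ∈ s.toRight, f (Sum.inr z)) = ∏ z ∈ s.toRight, P (f (Sum.inr z)) :=
    (iIndep_iff _ _).1 h.indep_clocks s.toRight fun z hz => hf _ (Finset.mem_toRight.1 hz)
  have hlr := (Indep_iff _ _ _).1 h.indep_arrows_clocks (⋂ p ∈ s.toLeft, f (Sum.inl p))
    (⋂ z ∈ s.toRight, f (Sum.inr z))
    (Finset.measurableSet_biInter _ fun p hp => by
      have hm : Measurable[MeasurableSpace.comap (fun ω (p : ZEven × ℕ) => η p.1 p.2 ω)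
          inferInstance] (η p.1 p.2) :=
        (measurable_pi_apply p).comp (comap_measurable fun ω (p : ZEven × ℕ) => η p.1 p.2 ω)
      exact hm.comap_le _ (hf _ (Finset.mem_toLeft.1 hp)))
    (Finset.measurableSet_biInter _ fun z hz => by
      have hm : Measurable[MeasurableSpace.comap (fun ω (z : ZEven) (t : ℝ≥0) => N z t ω)
          inferInstance] (fun ω (t : ℝ≥0) => N z t ω) :=
        (measurable_pi_apply z).comp (comap_measurable fun ω (z : ZEven) (t : ℝ≥0) => N z t ω)
      exact hm.comap_le _ (hf _ (Finset.mem_toRight.1 hz)))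
  rw [e, hlr, hl, hr]
  conv_rhs => rw [← Finset.toLeft_disjSum_toRight (u := s), Finset.prod_disjSum]

theorem IsDynamics.indep_siteSigma (h : IsDynamics P η N) {A B : Set ZEven} (hAB : Disjoint A B) :
    Indep (siteSigma η N A) (siteSigma η N B) P :=
  indep_iSup_of_disjoint h.inputSigma_le h.iIndep_inputSigma (hAB.preimage _)

theorem IsDynamics.measurable_clock (h : IsDynamics P η N) (z : ZEven) (t : ℝ≥0) :
    Measurable (N z t) := (h.clock z).measurable t

theorem IsDynamics.measureReal_clock_inter_arrow (h : IsDynamics P η N) (z : ZEven)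
    {s : Set (ℝ≥0 → ℕ)} {t : Set (ℕ → Bool)} (hs : MeasurableSet s) (ht : MeasurableSet t) :
    P.real ({ω | (fun u => N z u ω) ∈ s} ∩ {ω | (fun n => η z n ω) ∈ t}) =
      P.real {ω | (fun u => N z u ω) ∈ s} * P.real {ω | (fun n => η z n ω) ∈ t} := by
  refine measureReal_inter_of_indep (Indep.symm h.indep_arrows_clocks) ?_ ?_
  · exact ⟨(fun f => f z) ⁻¹' s, (measurable_pi_apply z) hs, rfl⟩
  · refine ⟨(fun f n => f (z, n)) ⁻¹' t, ?_, rfl⟩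
    exact (measurable_pi_lambda _ fun n => measurable_pi_apply (z, n)) ht

/-- The probability that the clock at `z` does not ring between `τ` and `τ'`. -/
theorem IsDynamics.measureReal_no_ring (h : IsDynamics P η N) (z : ZEven) {τ τ' : ℝ≥0}
    (hτ : τ ≤ τ') : P.real {ω | N z τ ω = N z τ' ω} = Real.exp (-((τ' : ℝ) - τ)) := by
  have hlaw := (h.clock z).law τ τ' hτ
  have hm : Measurable fun ω => N z τ' ω - N z τ ω :=
    (h.measurable_clock z τ').sub (h.measurable_clock z τ)
  have h1 : P.real {ω | N z τ' ω - N z τ ω = 0} = Real.exp (-((τ' : ℝ) - τ)) := by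
    have := poissonMeasure_real_singleton (τ' - τ) 0
    rw [← hlaw, map_measureReal_apply hm (measurableSet_singleton 0)] at this
    rw [NNReal.coe_sub hτ] at this
    refine Eq.trans ?_ (this.trans (by simp))
    rfl
  rw [← h1]
  refine measureReal_congr ?_
  -- Subtraction in `ℕ` truncates; monotonicity of the clock turns a zero difference into equality.
  filter_upwards [(h.clock z).mono] with ω hω
  have hle : N z τ ω ≤ N z τ' ω := hω hτ
  refine propext ?_
  change N z τ ω = N z τ' ω ↔ N z τ' ω - N z τ ω = 0
  omega

variable [IsProbabilityMeasure P]

theorem IsDynamics.measureReal_arrow (h : IsDynamics P η N) (z : ZEven) (n : ℕ) (b : Bool) :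
    P.real {ω | η z n ω = b} = 1 / 2 :=
  measureReal_eq_half (h.measurable_arrow z n) (h.fair z n) b

theorem IsDynamics.measureReal_arrow_pair (h : IsDynamics P η N) (z : ZEven) {j k : ℕ}
    (hjk : j ≠ k) (a b : Bool) : P.real {ω | η z j ω = a ∧ η z k ω = b} = 1 / 4 := by
  have hne : (z, j) ≠ (z, k) := fun e => hjk (congrArg Prod.snd e)
  have hi := h.indep_arrows.indepFun hne
  have := measureReal_inter_of_indep hi (s := {ω | η z j ω = a}) (t := {ω | η z k ω = b})
    ⟨{a}, measurableSet_singleton a, rfl⟩ ⟨{b}, measurableSet_singleton b, rfl⟩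
  rw [h.measureReal_arrow, h.measureReal_arrow] at this
  rw [Set.ofPred_and, this]
  norm_num

theorem IsDynamics.measureReal_config (h : IsDynamics P η N) (z : ZEven) (τ : ℝ≥0) (b : Bool) :
    P.real {ω | config η N τ ω z = b} = 1 / 2 := by
  have := measureReal_random_index (P := P) (h.measurable_clock z τ)
    (E := fun n => {ω | η z n ω = b})
    (fun n => h.measurable_arrow z n (measurableSet_singleton b)) Set.univ (c := 1 / 2)
    (by norm_num) fun n _ => by
      rw [← h.measureReal_arrow z n b]
      exact h.measureReal_clock_inter_arrow z (s := {f | f τ = n}) (t := {g | g n = b})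
        ((measurable_pi_apply τ : Measurable fun f : ℝ≥0 → ℕ => f τ) (measurableSet_singleton n))
        ((measurable_pi_apply n : Measurable fun g : ℕ → Bool => g n) (measurableSet_singleton b))
  simpa [config] using this

/-- If the clock has not rung in between, both times show the same arrow. Otherwise they show arrows
with different indices, which are independent. The indices are random but independent of the arrows.
-/
theorem IsDynamics.measureReal_config_same (h : IsDynamics P η N) (z : ZEven) {τ τ' : ℝ≥0}
    (hτ : τ ≤ τ') (a b : Bool) :
    P.real {ω | config η N τ ω z = a ∧ config η N τ' ω z = b} =
      Real.exp (-((τ' : ℝ) - τ)) * (if a = b then 1 / 2 else 0) +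
        (1 - Real.exp (-((τ' : ℝ) - τ))) / 4 := by
  set X : Ω → ℕ × ℕ := fun ω => (N z τ ω, N z τ' ω) with hX
  set E : ℕ × ℕ → Set Ω := fun p => {ω | η z p.1 ω = a ∧ η z p.2 ω = b} with hE
  have hXm : Measurable X := (h.measurable_clock z τ).prodMk (h.measurable_clock z τ')
  have hEm : ∀ p, MeasurableSet (E p) := fun p =>
    (h.measurable_arrow z p.1 (measurableSet_singleton a)).inter
      (h.measurable_arrow z p.2 (measurableSet_singleton b))
  have hind : ∀ p, P.real ({ω | X ω = p} ∩ E p) = P.real {ω | X ω = p} * P.real (E p) := by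
    intro p
    refine h.measureReal_clock_inter_arrow z (s := {f | (f τ, f τ') = p})
      (t := {g | g p.1 = a ∧ g p.2 = b}) ?_ ?_
    · have hm : Measurable fun f : ℝ≥0 → ℕ => (f τ, f τ') :=
        (measurable_pi_apply τ).prodMk (measurable_pi_apply τ')
      exact hm (measurableSet_singleton p)
    · have hm : Measurable fun g : ℕ → Bool => (g p.1, g p.2) :=
        (measurable_pi_apply p.1).prodMk (measurable_pi_apply p.2)
      have := hm (measurableSet_singleton (a, b))
      simpa [Set.preimage, Prod.ext_iff] using this
  have hB : MeasurableSet {ω | X ω ∈ {p : ℕ × ℕ | p.1 = p.2}} := hXm .of_discrete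
  have h1 := measureReal_random_index (P := P) hXm hEm {p | p.1 = p.2}
    (c := if a = b then 1 / 2 else 0) (by positivity) fun p (hp : p.1 = p.2) => by
      rw [hind]
      congr 1
      simp only [hE, hp]
      split_ifs with hab
      · subst hab
        simpa using h.measureReal_arrow z p.2 a
      · have : {ω | η z p.2 ω = a ∧ η z p.2 ω = b} = ∅ :=
          Set.eq_empty_of_forall_notMem fun ω hω => hab (hω.1.symm.trans hω.2)
        simp [this]
  have h2 := measureReal_random_index (P := P) hXm hEm {p | p.1 = p.2}ᶜ (c := 1 / 4)
    (by norm_num) fun p hp => by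
      rw [hind, ← h.measureReal_arrow_pair z hp a b]
  have hq : P.real {ω | X ω ∈ {p : ℕ × ℕ | p.1 = p.2}} = Real.exp (-((τ' : ℝ) - τ)) :=
    h.measureReal_no_ring z hτ
  have hq' : P.real {ω | X ω ∈ {p : ℕ × ℕ | p.1 = p.2}ᶜ} = 1 - Real.exp (-((τ' : ℝ) - τ)) := by
    rw [← hq, ← probReal_compl_eq_one_sub hB]
    rfl
  rw [hq] at h1
  rw [hq'] at h2
  have hsplit : {ω | config η N τ ω z = a ∧ config η N τ' ω z = b} =
      {ω | X ω ∈ {p : ℕ × ℕ | p.1 = p.2} ∧ ω ∈ E (X ω)} ∪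
        {ω | X ω ∈ {p : ℕ × ℕ | p.1 = p.2}ᶜ ∧ ω ∈ E (X ω)} := by
    ext ω
    change (ω ∈ E (X ω)) ↔ _ ∨ _
    by_cases hω : X ω ∈ {p : ℕ × ℕ | p.1 = p.2}
    · exact ⟨fun h => .inl ⟨hω, h⟩, fun h => h.elim And.right And.right⟩
    · exact ⟨fun h => .inr ⟨hω, h⟩, fun h => h.elim And.right And.right⟩
  have hEX : MeasurableSet {ω | config η N τ ω z = a ∧ config η N τ' ω z = b} :=
    h.siteSigma_le Set.univ _
      ((measurable_config (Set.mem_univ z) τ (measurableSet_singleton a)).inter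
        (measurable_config (Set.mem_univ z) τ' (measurableSet_singleton b)))
  rw [hsplit, measureReal_union, h1, h2]
  · ring
  · exact Set.disjoint_left.2 fun ω h1 h2 => h2.1 h1.1
  · exact (hXm (MeasurableSet.of_discrete (s := {p : ℕ × ℕ | p.1 = p.2}ᶜ))).inter hEX

theorem IsDynamics.measureReal_config_pair (h : IsDynamics P η N) (z z' : ZEven) {τ τ' : ℝ≥0}
    (hτ : τ ≤ τ') (i : Bool × Bool) :
    P.real {ω | config η N τ ω z = i.1 ∧ config η N τ' ω z' = i.2} =
      arrowWeight (Real.exp (-((τ' : ℝ) - τ))) (z = z') i := by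
  unfold arrowWeight
  split_ifs with hz hi
  · subst hz
    rw [h.measureReal_config_same z hτ, if_pos hi]
  · subst hz
    rw [h.measureReal_config_same z hτ, if_neg hi]
  · have := measureReal_inter_of_indep
      (h.indep_siteSigma (A := {z}) (B := {z'}) (by simpa using hz))
      (measurable_config (η := η) (N := N) (Set.mem_singleton z) τ (measurableSet_singleton i.1))
      (measurable_config (η := η) (N := N) (Set.mem_singleton z') τ'
        (measurableSet_singleton i.2))
    refine this.trans ?_
    have e1 := h.measureReal_config z τ i.1
    have e2 := h.measureReal_config z' τ' i.2
    calc _ = (1 / 2 : ℝ) * (1 / 2) := congrArg₂ _ e1 e2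
      _ = 1 / 4 := by norm_num

/-- The joint survival probability of the two walks. -/
theorem IsDynamics.measureReal_pair (h : IsDynamics P η N) {τ τ' : ℝ≥0} (hτ : τ ≤ τ') {L c : ℤ}
    (hL : L < 0) (hc : L ≤ c) (M : ℕ) :
    P.real {ω | ((∀ k ≤ M, L < walk η N τ ω k) ∧ c < walk η N τ ω M) ∧
        (∀ k ≤ M, L < walk η N τ' ω k) ∧ c < walk η N τ' ω M} =
      (stepOp (pairWeight (Real.exp (-((τ' : ℝ) - τ)))) pairStep (above L))^[M]
        (survProd L c 0) (0, 0) := by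
  set X : ℕ → Ω → ℤ × ℤ := fun n ω => (walk η N τ ω n, walk η N τ' ω n) with hX
  set Y : ℕ → Ω → Bool × Bool := fun n ω =>
    (config η N τ ω (follow (config η N τ ω) origin n),
      config η N τ' ω (follow (config η N τ' ω) origin n)) with hY
  have hXm : ∀ {k n : ℕ}, k ≤ n → Measurable[siteSigma η N (sitesBefore n)] (X k) :=
    fun hk => (measurable_pathFromOrigin τ hk).prodMk (measurable_pathFromOrigin τ' hk)
  have hcm : ∀ (σ : ℝ≥0) (n : ℕ),
      Measurable fun ω => config η N σ ω (follow (config η N σ ω) origin n) := by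
    intro σ n
    have h1 : Measurable fun p : Ω × ZEven => config η N σ p.1 p.2 :=
      measurable_from_prod_countable_left fun z =>
        (measurable_config (Set.mem_univ z) σ).mono (h.siteSigma_le _) le_rfl
    exact h1.comp (measurable_id.prodMk
      ((measurable_follow σ le_rfl).mono (h.siteSigma_le _) le_rfl))
  have key := measureReal_alive_eq_stepOp (P := P) (X := X) (Y := Y)
    (c := pairWeight (Real.exp (-((τ' : ℝ) - τ)))) (T := pairStep) (G := above L) (w₀ := (0, 0))
    ⟨hL, hL⟩ (fun ω => rfl)
    (fun n ω => Prod.ext (pathFromOrigin_succ _ n) (pathFromOrigin_succ _ n))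
    (fun n => (hXm le_rfl).mono (h.siteSigma_le _) le_rfl)
    (fun n => (hcm τ n).prodMk (hcm τ' n))
    (fun n w i => by
      -- A history in the event is used to name the two sites, which depend only on `w` and `n`; the
      -- empty case is trivial.
      rcases (alive X (above L) n ∩ {ω | X n ω = w}).eq_empty_or_nonempty with he | ⟨ω₀, hω₀⟩
      · simp [he]
      have hcoord : ∀ ω, X n ω = w → (follow (config η N τ ω) origin n).1 = (w.1, (n : ℤ)) ∧
          (follow (config η N τ' ω) origin n).1 = (w.2, (n : ℤ)) := by
        rintro ω rfl
        exact ⟨Prod.ext rfl (follow_origin_time _ n), Prod.ext rfl (follow_origin_time _ n)⟩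
      obtain ⟨hz1, hz2⟩ := hcoord ω₀ hω₀.2
      set z := follow (config η N τ ω₀) origin n
      set z' := follow (config η N τ' ω₀) origin n
      have hiff : z = z' ↔ w.1 = w.2 := by
        rw [Subtype.ext_iff, hz1, hz2]; simp
      have hset : alive X (above L) n ∩ {ω | X n ω = w} ∩ {ω | Y n ω = i} =
          alive X (above L) n ∩ {ω | X n ω = w} ∩
            {ω | config η N τ ω z = i.1 ∧ config η N τ' ω z' = i.2} := by
        ext ω
        refine and_congr_right fun hω => ?_
        have e1 : follow (config η N τ ω) origin n = z :=
          Subtype.ext ((hcoord ω hω.2).1.trans hz1.symm)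
        have e2 : follow (config η N τ' ω) origin n = z' :=
          Subtype.ext ((hcoord ω hω.2).2.trans hz2.symm)
        simp only [hY, Set.mem_ofPred_eq, e1, e2, Prod.ext_iff]
      -- The sites about to be read are at level `n`, while the past has used only lower levels.
      have hdisj : Disjoint (sitesBefore n) ({z, z'} : Set ZEven) := by
        refine Set.disjoint_left.2 fun y hy hy' => ?_
        have hy : y.1.2 < n := hy
        rcases hy' with rfl | rfl
        · rw [hz1] at hy; exact lt_irrefl _ hy
        · rw [hz2] at hy; exact lt_irrefl _ hy
      have hind := measureReal_inter_of_indep (h.indep_siteSigma hdisj)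
        (measurableSet_alive_inter (fun k hk => hXm hk) (above L) w)
        (MeasurableSet.inter
          (measurable_config (η := η) (N := N) (A := {z, z'}) (z := z) (by simp) τ
            (measurableSet_singleton i.1))
          (measurable_config (η := η) (N := N) (A := {z, z'}) (z := z') (by simp) τ'
            (measurableSet_singleton i.2)))
      rw [hset]
      refine hind.trans ?_
      have e := h.measureReal_config_pair z z' hτ i
      congr 1
      refine e.trans ?_
      simp only [pairWeight, arrowWeight, hiff])
    M (survProd L c 0) (above c) (fun w hw => by
      change payoff L c w.1 * payoff L c w.2 = _
      rw [payoff_of_gt hc hw.1, payoff_of_gt hc hw.2]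
      by_cases h1 : c < w.1 <;> by_cases h2 : c < w.2 <;> simp [above, h1, h2])
  rw [← key]
  congr 1
  ext ω
  simp only [alive, above, Set.mem_inter_iff, Set.mem_ofPred_eq, hX]
  constructor
  · rintro ⟨⟨a1, a2⟩, b1, b2⟩
    exact ⟨fun k hk => ⟨a1 k hk, b1 k hk⟩, a2, b2⟩
  · rintro ⟨a, b1, b2⟩
    exact ⟨⟨fun k hk => (a k hk).1, b1⟩, fun k hk => (a k hk).2, b2⟩

end Dynamics

/-! ### The event `O` in terms of integer times -/

/-- Nearest neighbour paths from `0`. -/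
def IsNearestNeighbor (s : ℕ → ℤ) : Prop := s 0 = 0 ∧ ∀ n, ∃ b, s (n + 1) = s n + incr b

theorem IsNearestNeighbor.even {s : ℕ → ℤ} (hs : IsNearestNeighbor s) (n : ℕ) :
    Even (s n + n) := by
  induction n with
  | zero => simp [hs.1]
  | succ n ih =>
    obtain ⟨b, hb⟩ := hs.2 n
    obtain ⟨k, hk⟩ := ih
    cases b <;> simp only [incr, Bool.false_eq_true, if_true, if_false] at hb
    · exact ⟨k, by push_cast; omega⟩
    · exact ⟨k + 1, by push_cast; omega⟩

theorem interp_natCast (s : ℕ → ℤ) (n : ℕ) : interp s n = s n := by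
  rw [interp_eq_of_mem s n n ⟨le_rfl, le_self_add⟩]
  simp

theorem rescale_mem_O {δ : ℝ≥0} {s : ℕ → ℤ} : rescale δ (toPath s) ∈ O ↔
    (∀ t : unitInterval, -1 < interp s (unitInterval.toNNReal t / δ ^ 2) * δ) ∧
      1 < interp s (1 / δ ^ 2) * δ := by
  have h1 : unitInterval.toNNReal 1 = 1 := rfl
  have : rescale δ (toPath s) 1 = interp s (1 / δ ^ 2) * δ := by
    rw [← h1]; rfl
  rw [← this]
  rfl

/-- At most one step is made by the final time, and the rescaled endpoint is then at most `1 / δ ≤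
1`. -/
theorem notMem_O_of_one_le {δ : ℝ≥0} (hδ : 1 ≤ δ) {s : ℕ → ℤ} (hs : IsNearestNeighbor s) :
    rescale δ (toPath s) ∉ O := by
  rw [rescale_mem_O]
  rintro ⟨-, h⟩
  have hδ' : (1 : ℝ) ≤ δ := by exact_mod_cast hδ
  have hle : (1 : ℝ≥0) / δ ^ 2 ≤ 1 := div_le_one_of_le₀ (one_le_pow₀ hδ) (by positivity)
  rw [interp_eq_of_mem s 0 _ ⟨by simp, by simpa using hle⟩] at h
  obtain ⟨b, hb⟩ := hs.2 0
  have h1 : (s 1 : ℝ) ≤ 1 := by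
    have : s 1 ≤ 1 := by
      rw [zero_add, hs.1] at hb
      rw [hb]
      cases b <;> simp [incr]
    exact_mod_cast this
  rw [hs.1] at h
  push_cast at h
  have h2 : (0 : ℝ) + (1 / (δ : ℝ) ^ 2 - 0) * (s (0 + 1) - 0) * δ = s 1 / δ := by
    field_simp; simp
  rw [zero_add] at h h2
  rw [h2, lt_div_iff₀ (by linarith)] at h
  linarith

/-- A linear piece is lowest at an endpoint, so integer times suffice. On the last, partial piece a
descending path is still above its final value, which exceeds `1 / δ`. -/
theorem rescale_mem_O_iff {δ : ℝ≥0} (hδ : 0 < δ) (s : ℕ → ℤ) :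
    rescale δ (toPath s) ∈ O ↔
      (∀ k ≤ ⌊(1 : ℝ≥0) / δ ^ 2⌋₊, -(1 / (δ : ℝ)) < s k) ∧ 1 / (δ : ℝ) < interp s (1 / δ ^ 2) := by
  have hδ' : (0 : ℝ) < δ := hδ
  rw [rescale_mem_O, ← div_lt_iff₀ hδ']
  refine and_congr_left fun hT => ?_
  have hneg : ∀ x : ℝ, -1 < x * δ ↔ -(1 / (δ : ℝ)) < x := by
    intro x
    rw [← div_lt_iff₀ hδ', neg_div]
  simp only [hneg]
  constructor
  · intro h k hk
    have hk' : (k : ℝ≥0) ≤ 1 / δ ^ 2 := (Nat.le_floor_iff (by positivity)).1 hk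
    have hk1 : (k : ℝ≥0) * δ ^ 2 ≤ 1 := by rwa [le_div_iff₀ (by positivity)] at hk'
    have := h ⟨(k : ℝ) * δ ^ 2, by positivity, by exact_mod_cast hk1⟩
    have e : unitInterval.toNNReal ⟨(k : ℝ) * δ ^ 2, by positivity, by exact_mod_cast hk1⟩ / δ ^ 2 =
        (k : ℝ≥0) := by
      rw [div_eq_iff (by positivity)]
      exact NNReal.eq (by simp [unitInterval.toNNReal]; rfl)
    rwa [e, interp_natCast] at this
  · intro h t
    set u : ℝ≥0 := unitInterval.toNNReal t / δ ^ 2 with hu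
    have ht : unitInterval.toNNReal t ≤ 1 := by
      have : (t : ℝ) ≤ 1 := t.2.2
      exact_mod_cast this
    have huT : u ≤ 1 / δ ^ 2 := by rw [hu]; gcongr
    set n := ⌊u⌋₊ with hn
    have hnu : (n : ℝ) ≤ u := by exact_mod_cast Nat.floor_le (zero_le (a := u))
    have hun : (u : ℝ) < n + 1 := by exact_mod_cast Nat.lt_floor_add_one u
    have hnN : n ≤ ⌊(1 : ℝ≥0) / δ ^ 2⌋₊ := Nat.floor_le_floor huT
    have hsn := h n hnN
    change _ < (s n : ℝ) + ((u : ℝ) - n) * (s (n + 1) - s n)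
    rcases le_or_gt 0 ((s (n + 1) : ℝ) - s n) with hd | hd
    · nlinarith
    · rcases hnN.lt_or_eq with hlt | heq
      · have := h (n + 1) hlt
        nlinarith
      · have hTu : (u : ℝ) ≤ (1 / δ ^ 2 : ℝ≥0) := by exact_mod_cast huT
        have : 1 / (δ : ℝ) < (s n : ℝ) + (((1 / δ ^ 2 : ℝ≥0) : ℝ) - n) * (s (n + 1) - s n) := by
          rw [heq]; exact hT
        have hpos : 0 < 1 / (δ : ℝ) := by positivity
        nlinarith

/-- For walks of fixed parity, the condition at a fractional time is a condition at one of the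
two neighbouring integer times. -/
theorem exists_integer_threshold {b θ : ℝ} (hb : 1 < b) (hθ : 0 ≤ θ) (hθ1 : θ < 1) (N : ℕ) :
    ∃ M c, (M = N ∨ M = N + 1) ∧ (0 : ℤ) ≤ c ∧ ∀ s, IsNearestNeighbor s →
      (b < (s N : ℝ) + θ * (s (N + 1) - s N) ↔ c < s M) := by
  -- `y` is the least integer of the parity of `N` above `b - θ`, hence the least `s N` from which a
  -- step to the right succeeds.
  obtain ⟨y, hyeven, hy, hy2⟩ : ∃ y : ℤ, Even (y + N) ∧ b - θ < y ∧ (y : ℝ) - 2 ≤ b - θ := by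
    have h1 := Int.lt_floor_add_one (b - θ)
    have h2 := Int.floor_le (b - θ)
    rcases Int.even_or_odd (⌊b - θ⌋ + 1 + N) with h | h
    · exact ⟨⌊b - θ⌋ + 1, h, by push_cast; linarith, by push_cast; linarith⟩
    · refine ⟨⌊b - θ⌋ + 2, ?_, by push_cast; linarith, by push_cast; linarith⟩
      obtain ⟨k, hk⟩ := h
      exact ⟨k + 1, by omega⟩
  have hy0 : (0 : ℤ) < y := by
    have : (0 : ℝ) < y := by linarith
    exact_mod_cast this
  have hright : ∀ x : ℤ, Even (x + N) → (b - θ < x ↔ y ≤ x) := by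
    intro x hx
    constructor
    · intro h
      by_contra hlt
      push Not at hlt
      have : x ≤ y - 2 := by
        obtain ⟨k, hk⟩ := hx
        obtain ⟨l, hl⟩ := hyeven
        omega
      have : (x : ℝ) ≤ y - 2 := by exact_mod_cast this
      linarith
    · intro h
      have : (y : ℝ) ≤ x := by exact_mod_cast h
      linarith
  have hstep : ∀ s, IsNearestNeighbor s →
      (s (N + 1) = s N + 1 ∧ (b < (s N : ℝ) + θ * (s (N + 1) - s N) ↔ y ≤ s N)) ∨
      (s (N + 1) = s N - 1 ∧ (b < (s N : ℝ) + θ * (s (N + 1) - s N) ↔ b + θ < s N)) := by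
    intro s hs
    obtain ⟨d, hd⟩ := hs.2 N
    cases d <;> simp only [incr, Bool.false_eq_true, if_true, if_false] at hd
    · right
      refine ⟨by omega, ?_⟩
      rw [hd]; push_cast
      constructor <;> intro <;> linarith
    · left
      refine ⟨hd, ?_⟩
      rw [← hright _ (hs.even N), hd]; push_cast
      constructor <;> intro <;> linarith
  -- A step to the left needs `s N > b + θ`. If `b + θ < y`, both directions ask for `s N ≥ y`, a
  -- condition at time `N`. Otherwise the left step needs `s N ≥ y + 2`, and both cases say `s (N +
  -- 1) > y`.
  rcases lt_or_ge (b + θ) y with hcase | hcase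
  · refine ⟨N, y - 1, .inl rfl, by omega, fun s hs => ?_⟩
    rcases hstep s hs with ⟨-, h⟩ | ⟨-, h⟩
    · rw [h]; omega
    · rw [h, Int.sub_one_lt_iff]
      constructor
      · intro h'
        exact (hright _ (hs.even N)).1 (by linarith)
      · intro h'
        have : (y : ℝ) ≤ s N := by exact_mod_cast h'
        linarith
  · refine ⟨N + 1, y, .inr rfl, by omega, fun s hs => ?_⟩
    rcases hstep s hs with ⟨e, h⟩ | ⟨e, h⟩
    · rw [h, e]; omega
    · rw [h, e]
      constructor
      · intro h'
        have : (y : ℝ) < s N := by linarith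
        have h1 : y < s N := by exact_mod_cast this
        obtain ⟨k, hk⟩ := hs.even N
        obtain ⟨l, hl⟩ := hyeven
        omega
      · intro h'
        have : (y : ℝ) + 2 ≤ s N := by exact_mod_cast (by omega : y + 2 ≤ s N)
        linarith

theorem exists_discrete_event {δ : ℝ≥0} (hδ : 0 < δ) (hδ1 : δ < 1) :
    ∃ (M : ℕ) (L c : ℤ), 0 < M ∧ 1 ≤ 2 * (δ : ℝ) ^ 2 * M ∧ L < 0 ∧ L ≤ c ∧
      ∀ s, IsNearestNeighbor s →
        (rescale δ (toPath s) ∈ O ↔ (∀ k ≤ M, L < s k) ∧ c < s M) := by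
  have hδ' : (0 : ℝ) < δ := hδ
  have hδ1' : (δ : ℝ) < 1 := hδ1
  set T : ℝ≥0 := 1 / δ ^ 2 with hT
  set N := ⌊T⌋₊ with hN
  have hTR : (T : ℝ) = 1 / (δ : ℝ) ^ 2 := by rw [hT]; push_cast; rfl
  have hT1 : 1 ≤ T := by
    rw [hT, le_div_iff₀ (by positivity), one_mul]
    exact pow_le_one₀ (by positivity) hδ1.le
  have hN1 : 1 ≤ N := Nat.le_floor (by exact_mod_cast hT1)
  have hNT : (N : ℝ) ≤ T := by exact_mod_cast Nat.floor_le (zero_le (a := T))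
  have hTN : (T : ℝ) < N + 1 := by exact_mod_cast Nat.lt_floor_add_one T
  have hb : 1 < 1 / (δ : ℝ) := by rwa [lt_div_iff₀ hδ', one_mul]
  obtain ⟨M, c, hM, hc, hiff⟩ := exists_integer_threshold hb (θ := T - N) (by linarith)
    (by linarith) N
  have hMN : N ≤ M := by omega
  have hL : ⌊-(1 / (δ : ℝ))⌋ < 0 := by
    rw [Int.floor_lt]
    push_cast
    linarith
  refine ⟨M, ⌊-(1 / (δ : ℝ))⌋, c, by omega, ?_, hL, by omega, fun s hs => ?_⟩
  · have h1 : (N : ℝ) ≤ M := by exact_mod_cast hMN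
    have h2 : (1 : ℝ) ≤ N := by exact_mod_cast hN1
    have h3 : (T : ℝ) ≤ 2 * M := by linarith
    rw [hTR, div_le_iff₀ (by positivity)] at h3
    linarith
  · rw [rescale_mem_O_iff hδ s]
    have e : interp s (1 / δ ^ 2) = (s N : ℝ) + ((T : ℝ) - N) * (s (N + 1) - s N) := rfl
    rw [e, hiff s hs]
    refine and_congr_left fun hcM => ?_
    simp only [← Int.floor_lt]
    constructor
    · intro h k hk
      -- If `M = N + 1`, survival at the extra time follows from `s M > c ≥ 0 > L`.
      rcases Nat.lt_or_ge N k with hlt | hge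
      · have : k = M := by omega
        rw [this]
        omega
      · exact h k hge
    · exact fun h k hk => h k (hk.trans hMN)

theorem isNearestNeighbor_pathFromOrigin (A : ZEven → Bool) :
    IsNearestNeighbor (pathFromOrigin A) :=
  ⟨rfl, fun n => ⟨_, pathFromOrigin_succ A n⟩⟩

theorem exp_neg_mul_le {D : ℝ} : Real.exp (-D) * D ≤ 1 - Real.exp (-D) := by
  have h := Real.add_one_le_exp D
  have h2 : Real.exp (-D) * Real.exp D = 1 := by rw [← Real.exp_add]; simp
  nlinarith [Real.exp_pos (-D)]

/-- The decorrelation bound for ordered dynamical times. -/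
theorem measureReal_pair_le {Ω : Type*} [MeasurableSpace Ω] {P : Measure Ω}
    [IsProbabilityMeasure P] {η : ZEven → ℕ → Ω → Bool} {N : ZEven → ℝ≥0 → Ω → ℕ}
    (h : IsDynamics P η N) {Ω' : Type*} [MeasurableSpace Ω'] {P' : Measure Ω'}
    [IsProbabilityMeasure P'] {S : ℕ → Ω' → ℤ} (hS : IsSimpleSymmetricWalk P' S)
    {δ τ τ' : ℝ≥0} (hδ : 0 < δ) (hτ : τ < τ') :
    P.real {ω | rescale δ (toPath (walk η N τ ω)) ∈ O ∧
        rescale δ (toPath (walk η N τ' ω)) ∈ O} ≤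
      P'.real {ω | rescale δ (toPath (fun n => S n ω)) ∈ O} ^ 2 +
        32 * ((δ : ℝ) / ((τ' : ℝ) - τ)) ^ (1 / 3 : ℝ) := by
  have hD : (0 : ℝ) < (τ' : ℝ) - τ := by
    have : (τ : ℝ) < τ' := hτ
    linarith
  have hδ' : (0 : ℝ) < δ := hδ
  have hwalk : ∀ σ ω, IsNearestNeighbor (walk η N σ ω) :=
    fun σ ω => isNearestNeighbor_pathFromOrigin _
  rcases le_or_gt 1 δ with hδ1 | hδ1
  · have : {ω | rescale δ (toPath (walk η N τ ω)) ∈ O ∧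
        rescale δ (toPath (walk η N τ' ω)) ∈ O} = ∅ :=
      Set.eq_empty_of_forall_notMem fun ω hω => notMem_O_of_one_le hδ1 (hwalk τ ω) hω.1
    rw [this, measureReal_empty]
    positivity
  obtain ⟨M, L, c, hM, hMδ, hL, hc, hiff⟩ := exists_discrete_event hδ hδ1
  have hM' : (0 : ℝ) < M := by exact_mod_cast hM
  have hS' : P'.real {ω | rescale δ (toPath (fun n => S n ω)) ∈ O} = surv L c M 0 := by
    rw [← hS.measureReal_surv hL hc M]
    refine measureReal_congr ?_
    filter_upwards [hS.ae_step] with ω hω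
    exact propext (hiff (fun n => S n ω) ⟨hω.1, fun n => ⟨_, hω.2 n⟩⟩)
  have hP : P.real {ω | rescale δ (toPath (walk η N τ ω)) ∈ O ∧
      rescale δ (toPath (walk η N τ' ω)) ∈ O} =
      (stepOp (pairWeight (Real.exp (-((τ' : ℝ) - τ)))) pairStep (above L))^[M]
        (survProd L c 0) (0, 0) := by
    simp only [hiff _ (hwalk _ _)]
    exact h.measureReal_pair hτ.le hL hc M
  rw [hS', hP]
  refine (stepOp_iterate_pair_le (Real.exp_pos _).le (Real.exp_le_one_iff.2 (by linarith)) hD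
    exp_neg_mul_le hL hM).trans ?_
  refine add_le_add_right ?_ _
  -- From `1 ≤ 2 δ² M`; the factor `2` here turns the constant `16` into `32`, through `2 ^ (1 / 3)
  -- ≤ 2`.
  have hs : 1 / √M ≤ 2 * δ := by
    rw [div_le_iff₀ (Real.sqrt_pos.2 hM')]
    refine (abs_le_of_sq_le_sq' ?_ (by positivity)).2
    rw [mul_pow, Real.sq_sqrt hM'.le]
    nlinarith
  have h2 : (2 : ℝ) ^ (1 / 3 : ℝ) ≤ 2 :=
    (Real.rpow_le_rpow_of_exponent_le (by norm_num) (by norm_num : (1 / 3 : ℝ) ≤ 1)).trans_eq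
      (Real.rpow_one 2)
  calc 16 * (1 / (√M * ((τ' : ℝ) - τ))) ^ (1 / 3 : ℝ)
      ≤ 16 * (2 * (δ / ((τ' : ℝ) - τ))) ^ (1 / 3 : ℝ) := by
        gcongr
        rw [← div_div, ← mul_div_assoc]
        gcongr
    _ = 16 * (2 ^ (1 / 3 : ℝ) * (δ / ((τ' : ℝ) - τ)) ^ (1 / 3 : ℝ)) := by
        rw [Real.mul_rpow (by norm_num) (by positivity)]
    _ ≤ 16 * (2 * (δ / ((τ' : ℝ) - τ)) ^ (1 / 3 : ℝ)) := by gcongr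
    _ = 32 * (δ / ((τ' : ℝ) - τ)) ^ (1 / 3 : ℝ) := by ring

end

end DyDW

theorem proposition3p1 :
    ∃ K a : ℝ, 0 < K ∧ 0 < a ∧
      ∀ {Ω : Type*} [MeasurableSpace Ω] (P : Measure Ω) [IsProbabilityMeasure P]
        (η : ZEven → ℕ → Ω → Bool) (N : ZEven → ℝ≥0 → Ω → ℕ), IsDynamics P η N →
      ∀ {Ω' : Type*} [MeasurableSpace Ω'] (P' : Measure Ω') [IsProbabilityMeasure P']
        (S : ℕ → Ω' → ℤ), IsSimpleSymmetricWalk P' S →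
      ∀ (δ τ τ' : ℝ≥0), 0 < δ → τ ≠ τ' →
        P.real {ω | rescale δ (toPath (walk η N τ ω)) ∈ O ∧
            rescale δ (toPath (walk η N τ' ω)) ∈ O} ≤
          P'.real {ω | rescale δ (toPath (fun n => S n ω)) ∈ O} ^ 2 +
            K * ((δ : ℝ) / |(τ : ℝ) - (τ' : ℝ)|) ^ a := by
  refine ⟨32, 1 / 3, by norm_num, by norm_num, ?_⟩
  intro Ω _ P _ η N h Ω' _ P' _ S hS δ τ τ' hδ hne
  rcases lt_or_gt_of_ne hne with hlt | hlt
  · have hlt' : (τ : ℝ) < τ' := hlt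
    rw [abs_sub_comm, abs_of_pos (by linarith)]
    exact measureReal_pair_le h hS hδ hlt
  · have hlt' : (τ' : ℝ) < τ := hlt
    rw [abs_of_pos (by linarith)]
    simp only [and_comm (a := rescale δ (toPath (walk η N τ _)) ∈ O)]
    exact measureReal_pair_le h hS hδ hlt
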